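/- **Setting.** Let $G=(V,E)$ be a finite undirected graph with root $r$, costs $c(v)\ge 0$ and penalties $\pi(v)\ge 0$. A vertex is *cheap* if $c(v)\le\pi(v)$ and *expensive* otherwise. The reduced cost and penalty are $\bar c(v)=0$, $\bar\pi(v)=\pi(v)-c(v)$ for cheap $v$, and $\bar c(v)=c(v)-\pi(v)$, $\bar\pi(v)=0$ for expensive $v$; put $\bar\pi(S)=\sum_{v\in S}\bar\pi(v)$. $\Gamma(S)$ is the set of vertices outside $S$ with a neighbour in $S$. **Phase.** A phase starts with a vertex set $T_r\ni r$ and a family $\mathcal C$ of *initial components*. All these sets are connected, they are pairwise disjoint and pairwise non-adjacent, and together they contain all cheap vertices. For $C\in\mathcal C$ and $\tau\ge0$ let $\mathrm{age}^\tau(C)=\min\{\tau,\bar\pi(C)\}$. The *core* of a set $S$ at time $\tau$ is the initial component contained in $S$ of largest age. **Dual growth.** At time $\tau=0$ the active moats are the members of $\mathcal C$, there are no inactive moats, and $y=0$. All $y_S$ with $S$ an active moat grow at unit rate as long as $\sum_{S:v\in\Gamma(S)}y_S\le\bar c(v)$ for all $v$ outside the moats and $\sum_{U\subseteq S}y_U\le\bar\pi(S)$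 for all active $S$. Let $\mathcal S^\tau$ be the family of all sets that have been moats up to time $\tau$. Events, in any order when simultaneous: * If $\sum_{U\subseteq S}y_U=\bar\pi(S)$ for an active moat $S$, then $S$ becomes inactive. * Suppose a vertex $\tilde v$ outside all moats, with an active moat adjacent to it, becomes tight, i.e. $\sum_{S:\tilde v\in\Gamma(S)}y_S=\bar c(\tilde v)$. A component $C\in\mathcal C$ *loads* $\tilde v$ if it is the core of some $S\in\mathcal S^\tau$ with $\tilde v\in\Gamma(S)$. If $\tilde v\in\Gamma(T_r)$, or if the ages $\mathrm{age}^\tau(C)$ of the components loading $\tilde v$ add up to at least $\frac32\tau$, the phase tree centered at $\tilde v$ is built and the phase ends at this time $\tau$. Otherwise $\tilde v$ and all moats adjacent to it are replaced by their union, a new active moat. **Auxiliary graphs.** From now on $\tau$ is the time at which the phase ends and $y$ the dual solution at that time. The *super-vertices* of $S\in\mathcal S^\tau$ are the inclusion-wise maximal sets among the proper subsets of $S$ that have been inactive moats. For a vertex set $X$, $H_S$ is obtained from $G[S\cup X]$ by contracting each super-vertex of $S$. The auxiliary cost $c_S$ of super-vertices and of vertices of $\mathrm{core}(S)$ is $0$.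 For any other original vertex $v$, $c_S(v)$ is the sum of $y_R$ over all $R\subseteq S$ with $v\in\Gamma(R)$ and $\mathrm{core}(R)=\mathrm{core}(S)$. The cost of a path is the sum of the costs of its vertices, end-points included. **Phase tree.** Start with the vertex set $T=\{\tilde v\}$ and call FindSubTree$(S,\{\tilde v\})$ for every inclusion-wise maximal $S\in\mathcal S^\tau$ with $\tilde v\in\Gamma(S)$. Choices left open below are arbitrary. *FindSubTree$(S,L)$*, where $L=\{a,b\}$, possibly $a=b$: 1. Choose a minimum-$c_S$-cost $a,b$-path $P$ in $H_S$ (with $X=L$) and add its original vertices to $T$. 2. Call FindSubTree$(R,\Gamma(R)\cap P)$ for every super-vertex $R$ of $S$ that neighbours an original vertex of $P$. 3. Choose $z_0\in\mathrm{core}(S)$, call ConnectVertex$(S,z_0,0)$, and add $\mathrm{core}(S)$ to $T$. *ConnectVertex$(S_d,z_d,d)$*: 1. Let $T$ be the vertex set of the current phase tree, and choose a minimum-$c_{S_d}$-cost path in $H_{S_d}$ (with $X=\{z_d\}\cup T$) from $z_d$ to $T$. Such a path meets $T$, in an original vertex of $T$ or in a super-vertex intersecting $T$, only at its last vertex $S_{d+1}$.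 2. If $S_{d+1}$ is a super-vertex, let $z_{d+1}$ be the second-last vertex, an original vertex, let $Q_d$ be the $z_d,z_{d+1}$-part of the path, and call ConnectVertex$(S_{d+1},z_{d+1},d+1)$. Otherwise $Q_d$ is the whole path; put $p=d+1$, and the chain of calls ends. 3. Add the original vertices of $Q_d$ to the phase tree, and call FindSubTree$(R,\Gamma(R)\cap Q_d)$ for every super-vertex $R$ of $S_d$ that neighbours an original vertex of $Q_d$ and did not intersect $T$ when this call of ConnectVertex was made. **Charges.** Each call FindSubTree$(S,L)$, with $S_0=S$ and the chain of ConnectVertex calls it starts, charges to $\mathrm{core}(S)$: * (C1) the auxiliary cost $c_S(P)$; * (C2) the auxiliary costs $\sum_{j=0}^{p-1}c_{S_j}(Q_j)$; * (C3) the non-auxiliary costs $\bar c(z_j)-c_{S_{j-1}}(z_j)$ of the vertices $z_1,\dots,z_{p-1}$, where a vertex that occurs several times in this list is charged once, for its first occurrence. For $C\in\mathcal C$ let $\Phi_1(C),\Phi_2(C),\Phi_3(C)$ be the total charges of these three types over all FindSubTree calls of the phase, and let $\Phi(C)=\Phi_1(C)+\Phi_2(C)+\Phi_3(C)$. **Corollary.**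 In any phase that ends at time $\tau$ with the construction of a phase tree, every $C\in\mathcal C$ satisfies $$\Phi_1(C)\le 2\,\mathrm{age}^\tau(C),\quad \Phi_2(C)\le 4\,\mathrm{age}^\tau(C),\quad \Phi_3(C)\le \mathrm{age}^\tau(C),$$ and hence $\Phi(C)\le 7\,\mathrm{age}^\tau(C)$. -/

import Mathlib

/-- A rooted node-weighted prize-collecting Steiner tree instance. -/
structure NWPCST (V : Type*) where
  G : SimpleGraph V
  root : V
  cost : V → ℝ
  penalty : V → ℝ
  cost_nonneg : ∀ v, 0 ≤ cost v
  penalty_nonneg : ∀ v, 0 ≤ penalty v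

namespace NWPCST

variable {V : Type*}

/-- A vertex is cheap if its cost is at most its penalty, and expensive otherwise. -/
def Cheap (I : NWPCST V) (v : V) : Prop := I.cost v ≤ I.penalty v

open Classical in
/-- Reduced cost. -/
noncomputable def rc (I : NWPCST V) (v : V) : ℝ :=
  if I.Cheap v then 0 else I.cost v - I.penalty v

open Classical in
/-- Reduced penalty. -/
noncomputable def rpi (I : NWPCST V) (v : V) : ℝ :=
  if I.Cheap v then I.penalty v - I.cost v else 0

open Classical in
/-- `Γ(S)`: the vertices outside `S` with a neighbour in `S`. -/
noncomputable def nbrs [Fintype V] (I : NWPCST V) (S : Finset V) : Finset V :=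
  Finset.univ.filter fun u => u ∉ S ∧ ∃ w ∈ S, I.G.Adj w u

/-- The situation at the beginning of a phase: `𝒞` is the family of initial components and `Tr` is
the component of the root. They are pairwise disjoint and pairwise non-adjacent connected vertex
sets, and they cover all the cheap vertices. -/
structure IsPhaseStart [Fintype V] (I : NWPCST V) (𝒞 : Finset (Finset V)) (Tr : Finset V) :
    Prop where
  root_mem : I.root ∈ Tr
  connected_root : (I.G.induce (Tr : Set V)).Connected
  connected : ∀ C ∈ 𝒞, (I.G.induce (C : Set V)).Connected
  disjoint_root : ∀ C ∈ 𝒞, Disjoint C Tr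
  not_adj_root : ∀ C ∈ 𝒞, Disjoint C (I.nbrs Tr)
  disjoint : ∀ C ∈ 𝒞, ∀ D ∈ 𝒞, C ≠ D → Disjoint C D
  not_adj : ∀ C ∈ 𝒞, ∀ D ∈ 𝒞, C ≠ D → Disjoint C (I.nbrs D)
  cheap_mem : ∀ v, I.Cheap v → v ∈ Tr ∨ ∃ C ∈ 𝒞, v ∈ C

/-- The age of an initial component `C` at time `τ`. -/
noncomputable def age (I : NWPCST V) (τ : ℝ) (C : Finset V) : ℝ :=
  min τ (∑ v ∈ C, I.rpi v)

/-- `C` is the core of `S`: it has the largest age among all the initial components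
contained in `S`. -/
def IsCore (I : NWPCST V) (𝒞 : Finset (Finset V)) (τ : ℝ) (S C : Finset V) : Prop :=
  C ∈ 𝒞 ∧ C ⊆ S ∧ ∀ D ∈ 𝒞, D ⊆ S → I.age τ D ≤ I.age τ C

/-- The state of the dual growing process. -/
structure DualState (V : Type*) where
  /-- the current time `τ` -/
  time : ℝ
  /-- the current active moats -/
  act : Finset (Finset V)
  /-- the current inactive moats -/
  inact : Finset (Finset V)
  /-- the dual solution -/
  y : Finset V → ℝ
  /-- all the sets that have been moats so far -/
  moats : Finset (Finset V)
  /-- all the sets that have been inactive moats so far -/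
  everInact : Finset (Finset V)

/-- The dual load of a vertex, i.e. the left-hand side of its cost constraint. -/
noncomputable def load [Fintype V] [DecidableEq V] (I : NWPCST V) (y : Finset V → ℝ) (v : V) : ℝ :=
  ∑ S ∈ Finset.univ.filter (fun S : Finset V => v ∈ I.nbrs S), y S

/-- The initial components that load the vertex `v`. -/
def loaders [Fintype V] [DecidableEq V] (I : NWPCST V) (𝒞 : Finset (Finset V)) (s : DualState V)
    (v : V) : Set (Finset V) :=
  {C | C ∈ 𝒞 ∧ ∃ S ∈ s.moats, v ∈ I.nbrs S ∧ I.IsCore 𝒞 s.time S C}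

open Classical in
/-- The ages of the components that load `v` add up to at least `(3/2) τ`. -/
def LargeLoad [Fintype V] [DecidableEq V] (I : NWPCST V) (𝒞 : Finset (Finset V)) (s : DualState V)
    (v : V) : Prop :=
  3 / 2 * s.time ≤ ∑ C ∈ 𝒞.filter (fun C => C ∈ I.loaders 𝒞 s v), I.age s.time C

/-- The current moats that neighbour `v`. (The current moats are pairwise disjoint, so
they are exactly the inclusion-wise maximal sets among `s.moats` that neighbour `v`.) -/
noncomputable def moatsAt [Fintype V] [DecidableEq V] (I : NWPCST V) (s : DualState V) (v : V) :
    Finset (Finset V) :=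
  (s.act ∪ s.inact).filter fun S => v ∈ I.nbrs S

/-- The cost constraint of `v`, a vertex outside all the moats that neighbours an active moat,
has become tight. -/
def TightEvent [Fintype V] [DecidableEq V] (I : NWPCST V) (s : DualState V) (v : V) : Prop :=
  (∀ S ∈ s.act ∪ s.inact, v ∉ S) ∧ (∃ S ∈ s.act, v ∈ I.nbrs S) ∧ I.load s.y v = I.rc v

/-- The dual solution after the active moats have grown for `ε` units of time. -/
noncomputable def grownDual [DecidableEq V] (s : DualState V) (ε : ℝ) (S : Finset V) : ℝ :=
  if S ∈ s.act then s.y S + ε else s.y S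

/-- The moat that replaces `v` and all the moats that neighbour it. -/
noncomputable def mergedMoat [Fintype V] [DecidableEq V] (I : NWPCST V) (s : DualState V) (v : V) :
    Finset V :=
  insert v ((I.moatsAt s v).biUnion id)

/-- `I.Reaches 𝒞 Tr s`: the dual growing process of the phase with initial components `𝒞` and root
component `Tr` can reach the state `s`. Simultaneous events may be processed in any order. -/
inductive Reaches [Fintype V] [DecidableEq V] (I : NWPCST V) (𝒞 : Finset (Finset V))
    (Tr : Finset V) : DualState V → Prop
  | start : Reaches I 𝒞 Tr
      { time := 0, act := 𝒞, inact := ∅, y := fun _ => 0, moats := 𝒞, everInact := ∅ }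
  /-- All the active moats grow at unit rate, as long as no constraint is violated. -/
  | grow (s : DualState V) (ε : ℝ) (hs : Reaches I 𝒞 Tr s) (hε : 0 < ε) (hact : s.act.Nonempty)
      (hcost : ∀ v, (∀ S ∈ s.act ∪ s.inact, v ∉ S) → I.load (grownDual s ε) v ≤ I.rc v)
      (hpen : ∀ S ∈ s.act, ∑ U ∈ S.powerset, grownDual s ε U ≤ ∑ v ∈ S, I.rpi v) :
      Reaches I 𝒞 Tr { s with time := s.time + ε, y := grownDual s ε }
  /-- The penalty constraint of an active moat is tight: it becomes inactive. -/
  | deactivate (s : DualState V) (S : Finset V) (hs : Reaches I 𝒞 Tr s) (hS : S ∈ s.act)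
      (htight : ∑ U ∈ S.powerset, s.y U = ∑ v ∈ S, I.rpi v) :
      Reaches I 𝒞 Tr { s with
        act := s.act.erase S
        inact := insert S s.inact
        everInact := insert S s.everInact }
  /-- The cost constraint of `v` is tight and the phase does not end: the moats that neighbour `v`
  are merged. -/
  | merge (s : DualState V) (v : V) (hs : Reaches I 𝒞 Tr s) (hv : I.TightEvent s v)
      (hroot : v ∉ I.nbrs Tr) (hload : ¬ I.LargeLoad 𝒞 s v) :
      Reaches I 𝒞 Tr { s with
        act := insert (I.mergedMoat s v) (s.act \ I.moatsAt s v)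
        inact := s.inact \ I.moatsAt s v
        moats := insert (I.mergedMoat s v) s.moats }

/-- The phase ends in state `s` with the construction of a phase tree centered at `v`. -/
def EndsAt [Fintype V] [DecidableEq V] (I : NWPCST V) (𝒞 : Finset (Finset V)) (Tr : Finset V)
    (s : DualState V) (v : V) : Prop :=
  I.TightEvent s v ∧ (v ∈ I.nbrs Tr ∨ I.LargeLoad 𝒞 s v)

/-! ### Auxiliary graphs -/

/-- The super-vertices of `H_S`: the inclusion-wise maximal sets among the proper
subsets of `S` that have been inactive moats (necessarily before `S` was formed). -/
def superVertices [DecidableEq V] (s : DualState V) (S : Finset V) : Finset (Finset V) :=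
  s.everInact.filter fun R => R ⊂ S ∧ ∀ R' ∈ s.everInact, R' ⊂ S → R ⊆ R' → R' = R

/-- A vertex of an auxiliary graph: an original vertex or a super-vertex. -/
inductive AuxVertex (V : Type*)
  | orig (v : V)
  | super (R : Finset V)

/-- The set of original vertices that a vertex of an auxiliary graph stands for. -/
def AuxVertex.verts : AuxVertex V → Finset V
  | .orig v => {v}
  | .super R => R

/-- The vertices of the graph obtained from `G[S ∪ X]` by identifying each super-vertex of `S`. -/
def IsAuxVertex [DecidableEq V] (s : DualState V) (S X : Finset V) : AuxVertex V → Prop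
  | .orig v => v ∈ S ∪ X ∧ ∀ R ∈ superVertices s S, v ∉ R
  | .super R => R ∈ superVertices s S

/-- The auxiliary graph `H_S`, obtained from `G[S ∪ X]` by identifying each super-vertex of `S`.
Elements of `AuxVertex V` that are not vertices of `H_S` are isolated. -/
def auxGraph [DecidableEq V] (I : NWPCST V) (s : DualState V) (S X : Finset V) :
    SimpleGraph (AuxVertex V) where
  Adj a b := a ≠ b ∧ IsAuxVertex s S X a ∧ IsAuxVertex s S X b ∧
    ∃ u ∈ a.verts, ∃ w ∈ b.verts, I.G.Adj u w
  symm := ⟨fun _ _ ⟨hab, ha, hb, u, hu, w, hw, huw⟩ =>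
    ⟨hab.symm, hb, ha, w, hw, u, hu, huw.symm⟩⟩
  loopless := ⟨fun _ h => h.1 rfl⟩

open Classical in
/-- The auxiliary cost `c_S(v)` of an original vertex, where `C` is the core of `S`: the dual load
that `v` feels from `C`. Vertices of the core have auxiliary cost `0`. -/
noncomputable def auxCost [Fintype V] [DecidableEq V] (I : NWPCST V) (𝒞 : Finset (Finset V))
    (s : DualState V) (S C : Finset V) (v : V) : ℝ :=
  if v ∈ C then 0 else
    ∑ R ∈ S.powerset.filter (fun R => v ∈ I.nbrs R ∧ I.IsCore 𝒞 s.time R C), s.y R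

/-- The auxiliary cost of a vertex of `H_S`; super-vertices have auxiliary cost `0`. -/
noncomputable def auxVertexCost [Fintype V] [DecidableEq V] (I : NWPCST V) (𝒞 : Finset (Finset V))
    (s : DualState V) (S C : Finset V) : AuxVertex V → ℝ
  | .orig v => I.auxCost 𝒞 s S C v
  | .super _ => 0

/-- The auxiliary cost `c_S(P)` of a path: the sum over all its vertices, end-points included. -/
noncomputable def pathCost [Fintype V] [DecidableEq V] (I : NWPCST V) (𝒞 : Finset (Finset V))
    (s : DualState V) (S C : Finset V) {X : Finset V} {a b : AuxVertex V}
    (p : (I.auxGraph s S X).Walk a b) : ℝ :=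
  (p.support.map (I.auxVertexCost 𝒞 s S C)).sum

open Classical in
/-- The original vertices on a path in an auxiliary graph. -/
noncomputable def origVerts {H : SimpleGraph (AuxVertex V)} [Fintype V] {a b : AuxVertex V}
    (p : H.Walk a b) : Finset V :=
  Finset.univ.filter fun v => AuxVertex.orig v ∈ p.support

/-- A vertex of an auxiliary graph belongs to the phase tree `T`, or is a super-vertex that
intersects it. -/
def AuxVertex.Meets [DecidableEq V] (a : AuxVertex V) (T : Finset V) : Prop :=
  (a.verts ∩ T).Nonempty

/-- `p` is a path in `H_S` of minimum auxiliary cost from `a` to the phase tree `T`. As usual, a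
path to `T` meets `T` in its last vertex only. -/
def IsShortestToTree [Fintype V] [DecidableEq V] (I : NWPCST V) (𝒞 : Finset (Finset V))
    (s : DualState V) (S C : Finset V) {X : Finset V} (T : Finset V) {a t : AuxVertex V}
    (p : (I.auxGraph s S X).Walk a t) : Prop :=
  p.IsPath ∧ t.Meets T ∧ (∀ b ∈ p.support, b.Meets T → b = t) ∧
    ∀ (t' : AuxVertex V) (q : (I.auxGraph s S X).Walk a t'), q.IsPath → t'.Meets T →
      I.pathCost 𝒞 s S C p ≤ I.pathCost 𝒞 s S C q

/-! ### Construction of the phase tree -/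

/-- The vertex set of the phase tree built so far, and, for each initial component, the total
charges of the types (C1), (C2) and (C3) that it has received so far. -/
structure BuildState (V : Type*) where
  tree : Finset V
  charge₁ : Finset V → ℝ
  charge₂ : Finset V → ℝ
  charge₃ : Finset V → ℝ

/-- The total charge `Φ(C)`. -/
def BuildState.totalCharge (B : BuildState V) (C : Finset V) : ℝ :=
  B.charge₁ C + B.charge₂ C + B.charge₃ C

/-- Add the vertices in `W` to the phase tree. -/
def BuildState.addVerts [DecidableEq V] (B : BuildState V) (W : Finset V) : BuildState V :=
  { B with tree := B.tree ∪ W }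

/-- Charge `x₁`, `x₂`, `x₃` to `C`, on top of what it has been charged before. -/
def BuildState.charge [DecidableEq V] (B : BuildState V) (C : Finset V) (x₁ x₂ x₃ : ℝ) :
    BuildState V :=
  { B with
    charge₁ := Function.update B.charge₁ C (B.charge₁ C + x₁)
    charge₂ := Function.update B.charge₂ C (B.charge₂ C + x₂)
    charge₃ := Function.update B.charge₃ C (B.charge₃ C + x₃) }

mutual

/-- `FindSubTree I 𝒞 s S L B B'`: a call of FindSubTree with parameters `S` and `L = {a, b}`
(possibly `a = b`), made when the phase tree and the charges are `B`, can end with `B'`;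
here `s` is the state in which the dual growing process ended. -/
inductive FindSubTree [Fintype V] [DecidableEq V] (I : NWPCST V) (𝒞 : Finset (Finset V))
    (s : DualState V) : Finset V → Finset V → BuildState V → BuildState V → Prop
  | intro {S L C : Finset V} {a b z : V} {B B₁ B₂ : BuildState V} {x₂ x₃ : ℝ}
      (hC : I.IsCore 𝒞 s.time S C) (hL : L = {a, b})
      (p : (I.auxGraph s S L).Walk (.orig a) (.orig b)) (hp : p.IsPath)
      (hmin : ∀ q : (I.auxGraph s S L).Walk (.orig a) (.orig b), q.IsPath →
        I.pathCost 𝒞 s S C p ≤ I.pathCost 𝒞 s S C q)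
      (hsub : FindSubTrees I 𝒞 s
        ((superVertices s S).filter fun R => (I.nbrs R ∩ origVerts p).Nonempty)
        (origVerts p) (B.addVerts (origVerts p)) B₁)
      (hz : z ∈ C)
      (hconn : ConnectVertex I 𝒞 s S z ∅ B₁ B₂ x₂ x₃) :
      FindSubTree I 𝒞 s S L B ((B₂.addVerts C).charge C (I.pathCost 𝒞 s S C p) x₂ x₃)

/-- `FindSubTrees I 𝒞 s rs Q B B'`: calling FindSubTree with parameters `R` and `Γ(R) ∩ Q` once for
each `R ∈ rs`, in some order, leads from `B` to `B'`. -/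
inductive FindSubTrees [Fintype V] [DecidableEq V] (I : NWPCST V) (𝒞 : Finset (Finset V))
    (s : DualState V) : Finset (Finset V) → Finset V → BuildState V → BuildState V → Prop
  | nil (Q : Finset V) (B : BuildState V) : FindSubTrees I 𝒞 s ∅ Q B B
  | cons {rs : Finset (Finset V)} {R Q : Finset V} {B B₁ B₂ : BuildState V} (hR : R ∈ rs)
      (hcall : FindSubTree I 𝒞 s R (I.nbrs R ∩ Q) B B₁)
      (hrest : FindSubTrees I 𝒞 s (rs.erase R) Q B₁ B₂) :
      FindSubTrees I 𝒞 s rs Q B B₂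

/-- `ConnectVertex I 𝒞 s S z paid B B' x₂ x₃`: a call of ConnectVertex with parameters `S = S_d` and
`z = z_d`, made when the phase tree and the charges are `B`, can end with `B'`. Here
`paid = {z_1, …, z_d}`, `x₂` is the auxiliary cost of the paths `Q_d, Q_{d+1}, …` of the chain of
calls that starts here, and `x₃` is the non-auxiliary cost of the vertices among
`z_{d+1}, z_{d+2}, …` that are not in `paid`, each of them counted once. -/
inductive ConnectVertex [Fintype V] [DecidableEq V] (I : NWPCST V) (𝒞 : Finset (Finset V))
    (s : DualState V) :
    Finset V → V → Finset V → BuildState V → BuildState V → ℝ → ℝ → Prop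
  /-- The path to the phase tree ends in an original vertex `t`: the chain of calls ends. -/
  | last {S C : Finset V} {z t : V} {paid : Finset V} {B B' : BuildState V}
      (hC : I.IsCore 𝒞 s.time S C)
      (q : (I.auxGraph s S (insert z B.tree)).Walk (.orig z) (.orig t))
      (hq : I.IsShortestToTree 𝒞 s S C B.tree q)
      (hsub : FindSubTrees I 𝒞 s
        ((superVertices s S).filter fun R =>
          R ∩ B.tree = ∅ ∧ (I.nbrs R ∩ origVerts q).Nonempty)
        (origVerts q) (B.addVerts (origVerts q)) B') :
      ConnectVertex I 𝒞 s S z paid B B' (I.pathCost 𝒞 s S C q) 0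
  /-- The path to the phase tree ends in a super-vertex `R`; its second-last vertex is `z'`. -/
  | step {S C R : Finset V} {z z' : V} {paid : Finset V} {B B₁ B' : BuildState V} {x₂ x₃ : ℝ}
      (hC : I.IsCore 𝒞 s.time S C)
      (q : (I.auxGraph s S (insert z B.tree)).Walk (.orig z) (.orig z'))
      (hadj : (I.auxGraph s S (insert z B.tree)).Adj (.orig z') (.super R))
      (hq : I.IsShortestToTree 𝒞 s S C B.tree (q.concat hadj))
      (hrec : ConnectVertex I 𝒞 s R z' (insert z' paid) B B₁ x₂ x₃)
      (hsub : FindSubTrees I 𝒞 s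
        ((superVertices s S).filter fun R' =>
          R' ∩ B.tree = ∅ ∧ (I.nbrs R' ∩ origVerts q).Nonempty)
        (origVerts q) (B₁.addVerts (origVerts q)) B') :
      ConnectVertex I 𝒞 s S z paid B B' (I.pathCost 𝒞 s S C q + x₂)
        ((if z' ∈ paid then 0 else I.rc z' - I.auxCost 𝒞 s S C z') + x₃)

end

/-- `B` is a possible result of the construction of the phase tree centered at `v`, which starts
from the single vertex `v` and no charges. -/
def BuildsTree [Fintype V] [DecidableEq V] (I : NWPCST V) (𝒞 : Finset (Finset V))
    (s : DualState V) (v : V) (B : BuildState V) : Prop :=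
  FindSubTrees I 𝒞 s (I.moatsAt s v) {v}
    { tree := {v}, charge₁ := fun _ => 0, charge₂ := fun _ => 0, charge₃ := fun _ => 0 } B

end NWPCST

/-!
Why the charges are bounded by the ages of the cores.

*Cores.* Let `τ` be the current time. An active moat has a core with reduced penalty at least `τ`,
hence of age `τ`. If the event at a vertex `v` does not end the phase, then the loading components
have total age less than `3τ/2`; therefore only one active moat `A` takes part in the merge at
`v`, the cores of the other moats at `v` have age less than `τ/2`, and they account for a load of
less than `τ/2`. So the core of a moat is unique, no merge changes the core of the active moat,
and a moat `S` arises from its core by successive merges, each of which adds a centre and some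
inactive moats. The inactive moats added by these merges are the super-vertices of `S`. This is
the content of `ProcessInv` and `MergeRecord`; `Reaches.processInv` proves the invariant. It
follows that the core of a super-vertex of `S` is at most half as old as `core(S)`
(`superVertex_core`), and that an original vertex of `H_S` in `S` outside the core, being the
centre of a merge, has non-auxiliary cost at most half the age of `core(S)` (`rc_sub_auxCost_le`).

*Paths.* Every vertex of `H_S` in `S` or `Γ(S)` has a walk to `core(S)` that follows the merges
backwards. The auxiliary costs of the centres on it are dual values of disjoint families of moats
with this core (`exists_walk_of_nbr`), so the walk costs at most `age(core(S))`, and two such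
walks joined in the core cost at most twice as much. This bounds the cost of every minimum path
that is chosen.

*Charges.* One call of FindSubTree on `S` charges at most `2 age(core(S))` for its own path. Along
the chain of ConnectVertex calls the ages of the cores at least halve in every step, so the paths
`Q_j` cost at most `2 (1 + 1/2 + 1/4 + ⋯) ≤ 4` times, and the vertices `z_j` at most `1/2 + 1/4 +
⋯ ≤ 1` times the age of the core (`connectVertex_step`). Here `z_{j+1}` is never in the core of
`S_j`, because super-vertices are not adjacent to it, and it lies outside `S_j` only if it is
`z_j` again, which has been paid for. Finally, no component is charged by two calls: FindSubTree
is called only on moats that the tree does not touch, and afterwards the tree contains the core.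
This bookkeeping is `Extends` and `ChargesOk`, and `FindSubTrees.spec` carries it through the
mutual recursion.
-/

namespace NWPCST

variable {V : Type*}

/-! ### Penalties and ages of initial components -/

/-- The reduced penalty `π̄(S)` of a vertex set. -/
noncomputable def pen (I : NWPCST V) (S : Finset V) : ℝ := ∑ v ∈ S, I.rpi v

/-- `C` is the dominant component of `S` at time `τ`: every other initial component inside `S` has a
smaller reduced penalty than `C`, and one smaller than `τ`. Unlike `IsCore`, this determines `C`,
and it persists when the time increases. -/
structure IsDominant (I : NWPCST V) (𝒞 : Finset (Finset V)) (τ : ℝ) (S C : Finset V) : Prop where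
  mem : C ∈ 𝒞
  subset : C ⊆ S
  lt : ∀ D ∈ 𝒞, D ⊆ S → D ≠ C → I.pen D < I.pen C ∧ I.pen D < τ

/-- The core of `S` as a function of `S` alone: the component that is dominant in `S` at some time
(and a junk value if there is none). -/
noncomputable def coreOf (I : NWPCST V) (𝒞 : Finset (Finset V)) (S : Finset V) : Finset V :=
  Classical.epsilon fun C => ∃ τ, I.IsDominant 𝒞 τ S C

section Ages

variable {I : NWPCST V} {𝒞 : Finset (Finset V)} {τ τ' : ℝ} {S C D : Finset V}

lemma rpi_nonneg (I : NWPCST V) (v : V) : 0 ≤ I.rpi v := by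
  unfold rpi Cheap
  split_ifs <;> linarith

lemma pen_nonneg (I : NWPCST V) (S : Finset V) : 0 ≤ I.pen S :=
  Finset.sum_nonneg fun v _ => I.rpi_nonneg v

lemma age_nonneg (I : NWPCST V) (hτ : 0 ≤ τ) (C : Finset V) : 0 ≤ I.age τ C :=
  le_min hτ (I.pen_nonneg C)

lemma IsDominant.mono (h : I.IsDominant 𝒞 τ S C) (hτ : τ ≤ τ') : I.IsDominant 𝒞 τ' S C :=
  ⟨h.mem, h.subset, fun D hD hDS hne =>
    ⟨(h.lt D hD hDS hne).1, (h.lt D hD hDS hne).2.trans_le hτ⟩⟩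

lemma IsDominant.unique (h : I.IsDominant 𝒞 τ S C) (h' : I.IsDominant 𝒞 τ' S D) : D = C := by
  by_contra hne
  exact lt_asymm (h.lt D h'.mem h'.subset hne).1 (h'.lt C h.mem h.subset (Ne.symm hne)).1

lemma IsDominant.coreOf_eq (h : I.IsDominant 𝒞 τ S C) : I.coreOf 𝒞 S = C := by
  have : ∃ τ, I.IsDominant 𝒞 τ S (I.coreOf 𝒞 S) :=
    Classical.epsilon_spec (p := fun C => ∃ τ, I.IsDominant 𝒞 τ S C) ⟨C, τ, h⟩
  obtain ⟨_, h'⟩ := this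
  exact h.unique h'

lemma IsDominant.age_lt (h : I.IsDominant 𝒞 τ S C) (hD : D ∈ 𝒞) (hDS : D ⊆ S) (hne : D ≠ C) :
    I.age τ D < I.age τ C := by
  have := h.lt D hD hDS hne
  exact (min_le_right _ _).trans_lt (lt_min this.2 this.1)

lemma IsDominant.isCore_iff (h : I.IsDominant 𝒞 τ S C) : I.IsCore 𝒞 τ S D ↔ D = C := by
  constructor
  · rintro ⟨hD, hDS, hmax⟩
    by_contra hne
    exact (h.age_lt hD hDS hne).not_ge (hmax C h.mem h.subset)
  · rintro rfl
    refine ⟨h.mem, h.subset, fun E hE hES => ?_⟩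
    by_cases hne : E = D
    · rw [hne]
    · exact (h.age_lt hE hES hne).le

end Ages

/-! ### The growing dual solution -/

lemma grownDual_eq [DecidableEq V] (s : DualState V) (ε : ℝ) (S : Finset V) :
    grownDual s ε S = s.y S + if S ∈ s.act then ε else 0 := by
  unfold grownDual; split_ifs <;> simp

lemma le_grownDual [DecidableEq V] (s : DualState V) {ε : ℝ} (hε : 0 < ε) (S : Finset V) :
    s.y S ≤ grownDual s ε S := by
  rw [grownDual_eq]; split_ifs <;> linarith

section DualGrowth

variable [Fintype V] {I : NWPCST V} {𝒞 : Finset (Finset V)} {Tr : Finset V}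

lemma mem_nbrs {u : V} {S : Finset V} : u ∈ I.nbrs S ↔ u ∉ S ∧ ∃ w ∈ S, I.G.Adj w u := by
  simp [nbrs]

lemma IsPhaseStart.nonempty (h : I.IsPhaseStart 𝒞 Tr) {C : Finset V} (hC : C ∈ 𝒞) :
    C.Nonempty := by
  obtain ⟨⟨x, hx⟩⟩ := (h.connected C hC).nonempty
  exact ⟨x, hx⟩

lemma IsPhaseStart.eq_of_subset (h : I.IsPhaseStart 𝒞 Tr) {C D : Finset V} (hC : C ∈ 𝒞)
    (hD : D ∈ 𝒞) (hDC : D ⊆ C) : D = C := by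
  by_contra hne
  obtain ⟨x, hx⟩ := h.nonempty hD
  exact Finset.disjoint_left.1 (h.disjoint D hD C hC hne) hx (hDC hx)

lemma IsPhaseStart.isDominant_self (h : I.IsPhaseStart 𝒞 Tr) {C : Finset V} (hC : C ∈ 𝒞) (τ : ℝ) :
    I.IsDominant 𝒞 τ C C :=
  ⟨hC, subset_rfl, fun _ hD hDC hne => absurd (h.eq_of_subset hC hD hDC) hne⟩

lemma IsPhaseStart.coreOf_eq (h : I.IsPhaseStart 𝒞 Tr) {C : Finset V} (hC : C ∈ 𝒞) :
    I.coreOf 𝒞 C = C :=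
  (h.isDominant_self hC 0).coreOf_eq

variable [DecidableEq V]

/-! ### The invariant of the dual growing process -/

/-- The dual load that `v` feels from the moats inside `S` with core `C`. -/
noncomputable def coreLoad (I : NWPCST V) (𝒞 : Finset (Finset V)) (y : Finset V → ℝ)
    (S C : Finset V) (v : V) : ℝ :=
  ∑ R ∈ S.powerset.filter (fun R => v ∈ I.nbrs R ∧ I.coreOf 𝒞 R = C), y R

/-- The total dual value of the sets with core `C`. -/
noncomputable def coreDual (I : NWPCST V) (𝒞 : Finset (Finset V)) (y : Finset V → ℝ)
    (C : Finset V) : ℝ :=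
  ∑ R ∈ Finset.univ.filter (fun R : Finset V => I.coreOf 𝒞 R = C), y R

/-- How the moat `S` arose at time `t`: the vertex `v` became tight, `A` was the only active moat at
`v`, the other moats at `v` were the members of `𝒟`, all of them inactive, and `v`, `A` and `𝒟` were
merged into `S`. The last fields record what this implies for the dual solution: since the
components loading `v` had total age less than `3t/2`, of which the core of `A` contributes `t`, the
cores of the members of `𝒟`, and the load that `v` feels from them, are at most `t/2`. -/
structure MergeRecord (I : NWPCST V) (𝒞 : Finset (Finset V)) (s : DualState V) (S A : Finset V)
    (v : V) (𝒟 : Finset (Finset V)) (t : ℝ) : Prop where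
  eq : S = insert v (A ∪ 𝒟.biUnion id)
  mem_moats : A ∈ s.moats
  core_eq : I.coreOf 𝒞 S = I.coreOf 𝒞 A
  not_everInact : A ∉ s.everInact
  nbr : v ∈ I.nbrs A
  everInact : ∀ D ∈ 𝒟, D ∈ s.everInact
  nbr' : ∀ D ∈ 𝒟, v ∈ I.nbrs D
  disj : ∀ D ∈ 𝒟, Disjoint A D
  not_adj : ∀ D ∈ 𝒟, Disjoint A (I.nbrs D)
  pairwise : ∀ D ∈ 𝒟, ∀ E ∈ 𝒟, D ≠ E → Disjoint D E
  le_time : t ≤ s.time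
  le_core : t ≤ I.pen (I.coreOf 𝒞 S)
  half : ∀ D ∈ 𝒟, I.pen (I.coreOf 𝒞 D) ≤ t / 2
  sub : ∀ R ∈ s.moats, R ⊂ S → R ⊆ A ∨ ∃ D ∈ 𝒟, R ⊆ D
  load_le : I.rc v - I.coreLoad 𝒞 s.y S (I.coreOf 𝒞 S) v ≤ t / 2

/-- The invariant of the dual growing process. -/
structure ProcessInv (I : NWPCST V) (𝒞 : Finset (Finset V)) (Tr : Finset V) (s : DualState V) :
    Prop where
  time_nonneg : 0 ≤ s.time
  y_nonneg : ∀ S, 0 ≤ s.y S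
  y_zero : ∀ S, S ∉ s.moats → s.y S = 0
  act_sub : s.act ⊆ s.moats
  inact_sub : s.inact ⊆ s.everInact
  ever_sub : s.everInact ⊆ s.moats
  act_not_ever : ∀ S ∈ s.act, S ∉ s.everInact
  init_sub : 𝒞 ⊆ s.moats
  disj : ∀ S ∈ s.act ∪ s.inact, ∀ M ∈ s.act ∪ s.inact, S ≠ M → Disjoint S M
  not_adj : ∀ S ∈ s.act ∪ s.inact, ∀ M ∈ s.act ∪ s.inact, S ≠ M → Disjoint S (I.nbrs M)
  sub_cur : ∀ R ∈ s.moats, ∃ M ∈ s.act ∪ s.inact, R ⊆ M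
  disj_root : ∀ S ∈ s.moats, Disjoint S Tr
  not_adj_root : ∀ S ∈ s.moats, Disjoint S (I.nbrs Tr)
  dom : ∀ S ∈ s.moats, I.IsDominant 𝒞 s.time S (I.coreOf 𝒞 S)
  slack_act : ∀ S ∈ s.act,
    I.pen S - ∑ U ∈ S.powerset, s.y U ≤ I.pen (I.coreOf 𝒞 S) - s.time
  le_act : ∀ S ∈ s.act, s.time ≤ I.pen (I.coreOf 𝒞 S)
  slack_inact : ∀ S ∈ s.inact, I.pen S ≤ ∑ U ∈ S.powerset, s.y U
  dual_le_time : ∀ C, I.coreDual 𝒞 s.y C ≤ s.time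
  dual_le_pen : ∀ C, I.coreDual 𝒞 s.y C ≤ I.pen C
  record : ∀ S ∈ s.moats, S ∈ 𝒞 ∨ ∃ A v 𝒟 t, I.MergeRecord 𝒞 s S A v 𝒟 t

lemma IsPhaseStart.processInv (h : I.IsPhaseStart 𝒞 Tr) : I.ProcessInv 𝒞 Tr
    { time := 0, act := 𝒞, inact := ∅, y := fun _ => 0, moats := 𝒞, everInact := ∅ } where
  time_nonneg := le_rfl
  y_nonneg _ := le_rfl
  y_zero _ _ := rfl
  act_sub := subset_rfl
  inact_sub := subset_rfl
  ever_sub := Finset.empty_subset _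
  act_not_ever _ _ := Finset.notMem_empty _
  init_sub := subset_rfl
  disj := by simpa using h.disjoint
  not_adj := by simpa using h.not_adj
  sub_cur R hR := ⟨R, by simpa using hR, subset_rfl⟩
  disj_root := h.disjoint_root
  not_adj_root := h.not_adj_root
  dom S hS := by
    rw [h.coreOf_eq hS]
    exact h.isDominant_self hS _
  slack_act S hS := by simp [h.coreOf_eq hS]
  le_act S _ := I.pen_nonneg _
  slack_inact S hS := by simp at hS
  dual_le_time C := by simp [coreDual]
  dual_le_pen C := by simpa [coreDual] using I.pen_nonneg C
  record S hS := Or.inl hS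

section Inv

variable {s : DualState V}

lemma ProcessInv.cur_sub (h : I.ProcessInv 𝒞 Tr s) : s.act ∪ s.inact ⊆ s.moats :=
  Finset.union_subset h.act_sub (h.inact_sub.trans h.ever_sub)

lemma ProcessInv.coreOf_mem (h : I.ProcessInv 𝒞 Tr s) {S : Finset V} (hS : S ∈ s.moats) :
    I.coreOf 𝒞 S ∈ 𝒞 := (h.dom S hS).mem

lemma ProcessInv.coreOf_subset (h : I.ProcessInv 𝒞 Tr s) {S : Finset V} (hS : S ∈ s.moats) :
    I.coreOf 𝒞 S ⊆ S := (h.dom S hS).subset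

lemma ProcessInv.nonempty (h : I.ProcessInv 𝒞 Tr s) (h₀ : I.IsPhaseStart 𝒞 Tr) {S : Finset V}
    (hS : S ∈ s.moats) : S.Nonempty :=
  (h₀.nonempty (h.coreOf_mem hS)).mono (h.coreOf_subset hS)

/-- Current moats that share a vertex coincide. -/
lemma ProcessInv.cur_eq (h : I.ProcessInv 𝒞 Tr s) {S M : Finset V} (hS : S ∈ s.act ∪ s.inact)
    (hM : M ∈ s.act ∪ s.inact) {x : V} (hxS : x ∈ S) (hxM : x ∈ M) : S = M := by
  by_contra hne
  exact Finset.disjoint_left.1 (h.disj S hS M hM hne) hxS hxM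

/-- Current moats are inclusion-wise maximal among the moats. -/
lemma ProcessInv.cur_max (h : I.ProcessInv 𝒞 Tr s) (h₀ : I.IsPhaseStart 𝒞 Tr) {S R : Finset V}
    (hS : S ∈ s.act ∪ s.inact) (hR : R ∈ s.moats) (hSR : S ⊆ R) : S = R := by
  obtain ⟨M, hM, hRM⟩ := h.sub_cur R hR
  obtain ⟨x, hx⟩ := h.nonempty h₀ (h.cur_sub hS)
  have : S = M := h.cur_eq hS hM hx (hRM (hSR hx))
  exact hSR.antisymm (this ▸ hRM)

/-- Distinct current moats have distinct cores. -/
lemma ProcessInv.cur_eq_of_core (h : I.ProcessInv 𝒞 Tr s) (h₀ : I.IsPhaseStart 𝒞 Tr)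
    {S M : Finset V} (hS : S ∈ s.act ∪ s.inact) (hM : M ∈ s.act ∪ s.inact)
    (hSM : I.coreOf 𝒞 S = I.coreOf 𝒞 M) : S = M := by
  obtain ⟨x, hx⟩ := h₀.nonempty (h.coreOf_mem (h.cur_sub hS))
  exact h.cur_eq hS hM (h.coreOf_subset (h.cur_sub hS) hx)
    (h.coreOf_subset (h.cur_sub hM) (hSM ▸ hx))

/-- A merge record persists as long as no new moat lies inside `S`, the moat `A` is not
declared inactive, and the sets inside `S` that neighbour `v` do not grow. -/
lemma MergeRecord.mono {s s' : DualState V} {S A : Finset V} {v : V} {𝒟 : Finset (Finset V)} {t : ℝ}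
    (h : I.MergeRecord 𝒞 s S A v 𝒟 t) (hm : s.moats ⊆ s'.moats)
    (hm' : ∀ R ∈ s'.moats, R ⊂ S → R ∈ s.moats)
    (he : s.everInact ⊆ s'.everInact) (hA : A ∉ s'.everInact) (ht : s.time ≤ s'.time)
    (hy : ∀ R, R ⊆ S → v ∈ I.nbrs R → s'.y R = s.y R) : I.MergeRecord 𝒞 s' S A v 𝒟 t where
  eq := h.eq
  mem_moats := hm h.mem_moats
  core_eq := h.core_eq
  not_everInact := hA
  nbr := h.nbr
  everInact D hD := he (h.everInact D hD)
  nbr' := h.nbr'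
  disj := h.disj
  not_adj := h.not_adj
  pairwise := h.pairwise
  le_time := h.le_time.trans ht
  le_core := h.le_core
  half := h.half
  sub R hR hRS := h.sub R (hm' R hR hRS) hRS
  load_le := by
    have : I.coreLoad 𝒞 s'.y S (I.coreOf 𝒞 S) v = I.coreLoad 𝒞 s.y S (I.coreOf 𝒞 S) v := by
      refine Finset.sum_congr rfl fun R hR => ?_
      simp only [Finset.mem_filter, Finset.mem_powerset] at hR
      exact hy R hR.1 hR.2.1
    rw [this]
    exact h.load_le

lemma MergeRecord.mem {S A : Finset V} {v : V} {𝒟 : Finset (Finset V)} {t : ℝ}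
    (h : I.MergeRecord 𝒞 s S A v 𝒟 t) : v ∈ S := by
  rw [h.eq]; exact Finset.mem_insert_self _ _

lemma MergeRecord.subset {S A : Finset V} {v : V} {𝒟 : Finset (Finset V)} {t : ℝ}
    (h : I.MergeRecord 𝒞 s S A v 𝒟 t) : A ⊆ S := by
  rw [h.eq]; exact Finset.subset_union_left.trans (Finset.subset_insert _ _)

lemma MergeRecord.ssubset {S A : Finset V} {v : V} {𝒟 : Finset (Finset V)} {t : ℝ}
    (h : I.MergeRecord 𝒞 s S A v 𝒟 t) : A ⊂ S :=
  (Finset.ssubset_iff_of_subset h.subset).2 ⟨v, h.mem, (mem_nbrs.1 h.nbr).1⟩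

lemma MergeRecord.subset' {S A : Finset V} {v : V} {𝒟 : Finset (Finset V)} {t : ℝ}
    (h : I.MergeRecord 𝒞 s S A v 𝒟 t) {D : Finset V} (hD : D ∈ 𝒟) : D ⊆ S := by
  rw [h.eq]
  exact (Finset.subset_biUnion_of_mem id hD).trans
    (Finset.subset_union_right.trans (Finset.subset_insert _ _))

lemma MergeRecord.ssubset' {S A : Finset V} {v : V} {𝒟 : Finset (Finset V)} {t : ℝ}
    (h : I.MergeRecord 𝒞 s S A v 𝒟 t) {D : Finset V} (hD : D ∈ 𝒟) : D ⊂ S :=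
  (Finset.ssubset_iff_of_subset (h.subset' hD)).2 ⟨v, h.mem, (mem_nbrs.1 (h.nbr' D hD)).1⟩

/-! ### Preservation of the invariant -/

/-- At most one active moat has core `C`, so that the dual value of `C` grows at most at unit
rate, and does not grow at all if there is none. -/
lemma ProcessInv.coreDual_grownDual (h : I.ProcessInv 𝒞 Tr s) (h₀ : I.IsPhaseStart 𝒞 Tr) (ε : ℝ)
    (C : Finset V) :
    (∃ M ∈ s.act, I.coreOf 𝒞 M = C ∧
      I.coreDual 𝒞 (grownDual s ε) C = I.coreDual 𝒞 s.y C + ε) ∨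
    I.coreDual 𝒞 (grownDual s ε) C = I.coreDual 𝒞 s.y C := by
  have key : I.coreDual 𝒞 (grownDual s ε) C = I.coreDual 𝒞 s.y C +
      ∑ R ∈ Finset.univ.filter (fun R : Finset V => I.coreOf 𝒞 R = C),
        if R ∈ s.act then ε else 0 := by
    unfold coreDual
    rw [← Finset.sum_add_distrib]
    exact Finset.sum_congr rfl fun R _ => grownDual_eq s ε R
  by_cases hex : ∃ M ∈ s.act, I.coreOf 𝒞 M = C
  · obtain ⟨M, hM, hMC⟩ := hex
    refine Or.inl ⟨M, hM, hMC, ?_⟩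
    rw [key, Finset.sum_eq_single M]
    · rw [if_pos hM]
    · intro R hR hne
      rw [if_neg]
      intro hRa
      refine hne (h.cur_eq_of_core h₀ (Finset.mem_union_left _ hRa) (Finset.mem_union_left _ hM) ?_)
      rw [(Finset.mem_filter.1 hR).2, hMC]
    · intro hM'
      simp [hMC] at hM'
  · right
    rw [key, Finset.sum_eq_zero, add_zero]
    intro R hR
    rw [if_neg]
    exact fun hRa => hex ⟨R, hRa, (Finset.mem_filter.1 hR).2⟩

lemma ProcessInv.grow (h : I.ProcessInv 𝒞 Tr s) (h₀ : I.IsPhaseStart 𝒞 Tr) {ε : ℝ} (hε : 0 < ε)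
    (hpen : ∀ S ∈ s.act, ∑ U ∈ S.powerset, grownDual s ε U ≤ ∑ v ∈ S, I.rpi v) :
    I.ProcessInv 𝒞 Tr { s with time := s.time + ε, y := grownDual s ε } := by
  have slack : ∀ S ∈ s.act, I.pen S - ∑ U ∈ S.powerset, grownDual s ε U ≤
      I.pen (I.coreOf 𝒞 S) - (s.time + ε) := by
    intro S hS
    have h1 := h.slack_act S hS
    have h2 : ∑ U ∈ S.powerset, s.y U + ε ≤ ∑ U ∈ S.powerset, grownDual s ε U := by
      simp only [grownDual_eq, Finset.sum_add_distrib]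
      have : (if S ∈ s.act then ε else 0) ≤ ∑ U ∈ S.powerset, if U ∈ s.act then ε else 0 :=
        Finset.single_le_sum (f := fun U => if U ∈ s.act then ε else 0)
          (fun U _ => by split_ifs <;> linarith) (Finset.mem_powerset_self S)
      rw [if_pos hS] at this
      linarith
    linarith
  have le_act : ∀ S ∈ s.act, s.time + ε ≤ I.pen (I.coreOf 𝒞 S) := by
    intro S hS
    have h1 := slack S hS
    have h2 := hpen S hS
    unfold pen at h1 ⊢
    linarith
  exact
  { time_nonneg := by have := h.time_nonneg; dsimp only; linarith
    y_nonneg := fun S => (h.y_nonneg S).trans (le_grownDual s hε S)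
    y_zero := fun S hS => by
      change grownDual s ε S = 0
      rw [grownDual_eq, h.y_zero S hS, if_neg fun hS' => hS (h.act_sub hS'), add_zero]
    act_sub := h.act_sub
    inact_sub := h.inact_sub
    ever_sub := h.ever_sub
    act_not_ever := h.act_not_ever
    init_sub := h.init_sub
    disj := h.disj
    not_adj := h.not_adj
    sub_cur := h.sub_cur
    disj_root := h.disj_root
    not_adj_root := h.not_adj_root
    dom := fun S hS => (h.dom S hS).mono (le_add_of_nonneg_right hε.le)
    slack_act := slack
    le_act := le_act
    slack_inact := fun S hS => (h.slack_inact S hS).trans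
      (Finset.sum_le_sum fun U _ => le_grownDual s hε U)
    dual_le_time := fun C => by
      have := h.dual_le_time C
      dsimp only
      rcases h.coreDual_grownDual h₀ ε C with ⟨_, _, _, h1⟩ | h1 <;> linarith
    dual_le_pen := fun C => by
      have ht := h.dual_le_time C
      have hp := h.dual_le_pen C
      dsimp only
      rcases h.coreDual_grownDual h₀ ε C with ⟨M, hM, hMC, h1⟩ | h1
      · have := le_act M hM
        rw [hMC] at this
        linarith
      · linarith
    record := fun S hS => by
      rcases h.record S hS with hS' | ⟨A, v, 𝒟, t, hr⟩
      · exact Or.inl hS'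
      · refine Or.inr ⟨A, v, 𝒟, t, hr.mono subset_rfl (fun _ hR _ => hR) subset_rfl
          hr.not_everInact (le_add_of_nonneg_right hε.le) fun R hRS hvR => ?_⟩
        change grownDual s ε R = s.y R
        rw [grownDual_eq, if_neg, add_zero]
        intro hR
        have : R = S := h.cur_max h₀ (Finset.mem_union_left _ hR) hS hRS
        exact (mem_nbrs.1 hvR).1 (this ▸ hr.mem) }

lemma ProcessInv.deactivate (h : I.ProcessInv 𝒞 Tr s) (h₀ : I.IsPhaseStart 𝒞 Tr) {S : Finset V}
    (hS : S ∈ s.act) (htight : ∑ U ∈ S.powerset, s.y U = ∑ v ∈ S, I.rpi v) :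
    I.ProcessInv 𝒞 Tr { s with
        act := s.act.erase S
        inact := insert S s.inact
        everInact := insert S s.everInact } := by
  have hcur : s.act.erase S ∪ insert S s.inact = s.act ∪ s.inact := by
    ext M
    by_cases hM : M = S <;> simp [hM, hS]
  exact
  { time_nonneg := h.time_nonneg
    y_nonneg := h.y_nonneg
    y_zero := h.y_zero
    act_sub := (Finset.erase_subset _ _).trans h.act_sub
    inact_sub := Finset.insert_subset_insert _ h.inact_sub
    ever_sub := Finset.insert_subset (h.act_sub hS) h.ever_sub
    act_not_ever := fun M hM => by
      rw [Finset.mem_erase] at hM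
      simp only [Finset.mem_insert, not_or]
      exact ⟨hM.1, h.act_not_ever M hM.2⟩
    init_sub := h.init_sub
    disj := by dsimp only; rw [hcur]; exact h.disj
    not_adj := by dsimp only; rw [hcur]; exact h.not_adj
    sub_cur := by dsimp only; rw [hcur]; exact h.sub_cur
    disj_root := h.disj_root
    not_adj_root := h.not_adj_root
    dom := h.dom
    slack_act := fun M hM => h.slack_act M (Finset.mem_of_mem_erase hM)
    le_act := fun M hM => h.le_act M (Finset.mem_of_mem_erase hM)
    slack_inact := fun M hM => by
      rcases Finset.mem_insert.1 hM with rfl | hM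
      · exact htight.ge
      · exact h.slack_inact M hM
    dual_le_time := h.dual_le_time
    dual_le_pen := h.dual_le_pen
    record := fun M hM => by
      rcases h.record M hM with hM' | ⟨A, v, 𝒟, t, hr⟩
      · exact Or.inl hM'
      · refine Or.inr ⟨A, v, 𝒟, t, hr.mono subset_rfl (fun _ hR _ => hR)
          (Finset.subset_insert _ _) ?_ le_rfl fun _ _ _ => rfl⟩
        simp only [Finset.mem_insert, not_or]
        refine ⟨?_, hr.not_everInact⟩
        rintro rfl
        exact hr.ssubset.ne (h.cur_max h₀ (Finset.mem_union_left _ hS) hM hr.subset) }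

end Inv

end DualGrowth


section Merge

variable [Fintype V] {I : NWPCST V} {𝒞 : Finset (Finset V)} {Tr : Finset V} [DecidableEq V]
  {s : DualState V}

lemma mem_moatsAt {v : V} {M : Finset V} :
    M ∈ I.moatsAt s v ↔ M ∈ s.act ∪ s.inact ∧ v ∈ I.nbrs M := by
  simp [moatsAt]

lemma mem_mergedMoat {v x : V} :
    x ∈ I.mergedMoat s v ↔ x = v ∨ ∃ M ∈ I.moatsAt s v, x ∈ M := by
  simp [mergedMoat]

lemma subset_mergedMoat {v : V} {M : Finset V} (hM : M ∈ I.moatsAt s v) :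
    M ⊆ I.mergedMoat s v :=
  fun _ hx => mem_mergedMoat.2 (Or.inr ⟨M, hM, hx⟩)

lemma ProcessInv.mem_loaders (h : I.ProcessInv 𝒞 Tr s) {v : V} {C : Finset V} :
    C ∈ I.loaders 𝒞 s v ↔ ∃ R ∈ s.moats, v ∈ I.nbrs R ∧ I.coreOf 𝒞 R = C := by
  constructor
  · rintro ⟨_, R, hR, hv, hC⟩
    exact ⟨R, hR, hv, ((h.dom R hR).isCore_iff.1 hC).symm⟩
  · rintro ⟨R, hR, hv, rfl⟩
    exact ⟨h.coreOf_mem hR, R, hR, hv, (h.dom R hR).isCore_iff.2 rfl⟩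

lemma ProcessInv.coreDual_le_age (h : I.ProcessInv 𝒞 Tr s) (C : Finset V) :
    I.coreDual 𝒞 s.y C ≤ I.age s.time C :=
  le_min (h.dual_le_time C) (h.dual_le_pen C)

/-- A moat that exists before the merge at `v` and lies inside the merged moat is part of one of the
moats that are merged. -/
lemma ProcessInv.exists_moatsAt (h : I.ProcessInv 𝒞 Tr s) (h₀ : I.IsPhaseStart 𝒞 Tr) {v : V}
    (hv : ∀ S ∈ s.act ∪ s.inact, v ∉ S) {R : Finset V} (hR : R ∈ s.moats)
    (hRM : R ⊆ I.mergedMoat s v) : ∃ M ∈ I.moatsAt s v, R ⊆ M := by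
  obtain ⟨M, hM, hRM'⟩ := h.sub_cur R hR
  obtain ⟨x, hx⟩ := h.nonempty h₀ hR
  rcases mem_mergedMoat.1 (hRM hx) with rfl | ⟨M', hM', hxM'⟩
  · exact absurd (hRM' hx) (hv M hM)
  · obtain rfl := h.cur_eq hM (mem_moatsAt.1 hM').1 (hRM' hx) hxM'
    exact ⟨M, hM', hRM'⟩

lemma ProcessInv.not_mem_moat (h : I.ProcessInv 𝒞 Tr s) {v : V}
    (hv : ∀ S ∈ s.act ∪ s.inact, v ∉ S) {R : Finset V} (hR : R ∈ s.moats) : v ∉ R := by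
  obtain ⟨M, hM, hRM⟩ := h.sub_cur R hR
  exact fun hvR => hv M hM (hRM hvR)

/-- If an event does not end the phase, the ages of the components that load `v` other than the core
of the active moat `A` at `v` add up to less than half the current time. -/
lemma ProcessInv.sum_age_loaders_lt (h : I.ProcessInv 𝒞 Tr s) {v : V}
    (hload : ¬ I.LargeLoad 𝒞 s v) {A : Finset V} (hA : A ∈ s.act) (hvA : v ∈ I.nbrs A)
    (𝓔 : Finset (Finset V))
    (h𝓔 : ∀ C ∈ 𝓔, C ≠ I.coreOf 𝒞 A ∧ ∃ R ∈ s.moats, v ∈ I.nbrs R ∧ I.coreOf 𝒞 R = C) :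
    ∑ C ∈ 𝓔, I.age s.time C < s.time / 2 := by
  classical
  have hage : I.age s.time (I.coreOf 𝒞 A) = s.time := min_eq_left (h.le_act A hA)
  have hnot : I.coreOf 𝒞 A ∉ 𝓔 := fun hmem => (h𝓔 _ hmem).1 rfl
  have hsub : insert (I.coreOf 𝒞 A) 𝓔 ⊆ 𝒞.filter fun C => C ∈ I.loaders 𝒞 s v := by
    intro C hC
    have : ∃ R ∈ s.moats, v ∈ I.nbrs R ∧ I.coreOf 𝒞 R = C := by
      rcases Finset.mem_insert.1 hC with rfl | hC
      · exact ⟨A, h.act_sub hA, hvA, rfl⟩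
      · exact (h𝓔 C hC).2
    have hC' := h.mem_loaders.2 this
    exact Finset.mem_filter.2 ⟨hC'.1, hC'⟩
  have hle := Finset.sum_le_sum_of_subset_of_nonneg hsub
    (fun C _ _ => I.age_nonneg h.time_nonneg C)
  rw [Finset.sum_insert hnot, hage] at hle
  unfold LargeLoad at hload
  rw [not_le] at hload
  have : ∑ C ∈ 𝒞.filter (fun C => C ∈ I.loaders 𝒞 s v), I.age s.time C < 3 / 2 * s.time := by
    convert hload
  linarith

/-- The load of a tight vertex that is not felt from the core of the active moat `A` is at most half
the current time. -/
lemma ProcessInv.load_sub_le (h : I.ProcessInv 𝒞 Tr s) {v : V}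
    (hv : I.TightEvent s v) (hload : ¬ I.LargeLoad 𝒞 s v) {A : Finset V} (hA : A ∈ s.act)
    (hvA : v ∈ I.nbrs A) :
    I.rc v - I.coreLoad 𝒞 s.y (I.mergedMoat s v) (I.coreOf 𝒞 A) v ≤ s.time / 2 := by
  set C₀ := I.coreOf 𝒞 A with hC₀
  set N := s.moats.filter fun R => v ∈ I.nbrs R with hN
  have hrc : I.rc v = ∑ R ∈ N, s.y R := by
    rw [← hv.2.2, load]
    refine (Finset.sum_subset (fun R hR => ?_) fun R hR hR' => ?_).symm
    · simp only [hN, Finset.mem_filter, Finset.mem_univ, true_and] at hR ⊢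
      exact hR.2
    · simp only [hN, Finset.mem_filter, Finset.mem_univ, true_and] at hR hR'
      exact h.y_zero R fun hRm => hR' ⟨hRm, hR⟩
  have hsplit := Finset.sum_filter_add_sum_filter_not N (fun R => I.coreOf 𝒞 R = C₀) s.y
  have hfirst : ∑ R ∈ N with I.coreOf 𝒞 R = C₀, s.y R ≤
      I.coreLoad 𝒞 s.y (I.mergedMoat s v) C₀ v := by
    refine Finset.sum_le_sum_of_subset_of_nonneg (fun R hR => ?_) fun R _ _ => h.y_nonneg R
    simp only [hN, Finset.mem_filter, Finset.mem_powerset] at hR ⊢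
    obtain ⟨M, hM, hRM⟩ := h.sub_cur R hR.1.1
    obtain ⟨w, hw, hwv⟩ := (mem_nbrs.1 hR.1.2).2
    exact ⟨hRM.trans (subset_mergedMoat
      (mem_moatsAt.2 ⟨hM, mem_nbrs.2 ⟨hv.1 M hM, w, hRM hw, hwv⟩⟩)), hR.1.2, hR.2⟩
  have hsecond : ∑ R ∈ N with ¬ I.coreOf 𝒞 R = C₀, s.y R ≤ s.time / 2 := by
    set N' := N.filter fun R => ¬ I.coreOf 𝒞 R = C₀ with hN'
    rw [← Finset.sum_fiberwise_of_maps_to (g := I.coreOf 𝒞) (t := N'.image (I.coreOf 𝒞))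
      fun R hR => Finset.mem_image_of_mem _ hR]
    refine le_trans (Finset.sum_le_sum fun C _ => ?_)
      (h.sum_age_loaders_lt hload hA hvA (N'.image (I.coreOf 𝒞)) fun C hC => ?_).le
    · refine le_trans ?_ (h.coreDual_le_age C)
      refine Finset.sum_le_sum_of_subset_of_nonneg (fun R hR => ?_) fun R _ _ => h.y_nonneg R
      simp only [Finset.mem_filter, Finset.mem_univ, true_and] at hR ⊢
      exact hR.2
    · obtain ⟨R, hR, rfl⟩ := Finset.mem_image.1 hC
      simp only [hN', hN, Finset.mem_filter] at hR
      exact ⟨hR.2, R, hR.1.1, hR.1.2, rfl⟩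
  linarith

/-- Vertices outside the moats that neighbour a moat are expensive, and not in the root component:
no moat is adjacent to the root component. -/
lemma ProcessInv.rpi_eq_zero (h : I.ProcessInv 𝒞 Tr s) (h₀ : I.IsPhaseStart 𝒞 Tr) {v : V}
    (hv : ∀ S ∈ s.act ∪ s.inact, v ∉ S) {A : Finset V} (hA : A ∈ s.moats)
    (hvA : v ∈ I.nbrs A) : v ∉ Tr ∧ I.rpi v = 0 := by
  have hTr : v ∉ Tr := by
    intro hvT
    obtain ⟨w, hw, hwv⟩ := (mem_nbrs.1 hvA).2
    refine Finset.disjoint_left.1 (h.not_adj_root A hA) hw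
      (mem_nbrs.2 ⟨Finset.disjoint_left.1 (h.disj_root A hA) hw, v, hvT, hwv.symm⟩)
  refine ⟨hTr, if_neg fun hch => ?_⟩
  rcases h₀.cheap_mem v hch with hvT | ⟨C, hC, hvC⟩
  · exact hTr hvT
  · exact h.not_mem_moat hv (h.init_sub hC) hvC

/-- Merging does not increase the slack of the penalty constraint of the active moat `A`. -/
lemma ProcessInv.slack_mergedMoat (h : I.ProcessInv 𝒞 Tr s) (h₀ : I.IsPhaseStart 𝒞 Tr) {v : V}
    (hv : ∀ S ∈ s.act ∪ s.inact, v ∉ S) (hrpi : I.rpi v = 0) {A : Finset V}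
    (hA : A ∈ I.moatsAt s v) (hinact : ∀ M ∈ I.moatsAt s v, M ≠ A → M ∈ s.inact) :
    I.pen (I.mergedMoat s v) - ∑ U ∈ (I.mergedMoat s v).powerset, s.y U ≤
      I.pen A - ∑ U ∈ A.powerset, s.y U := by
  set At := I.moatsAt s v with hAt
  have hpen : I.pen (I.mergedMoat s v) = ∑ M ∈ At, I.pen M := by
    unfold pen mergedMoat
    rw [Finset.sum_insert, hrpi, zero_add, Finset.sum_biUnion]
    · rfl
    · intro M hM M' hM' hne
      exact h.disj M (mem_moatsAt.1 hM).1 M' (mem_moatsAt.1 hM').1 hne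
    · simp only [Finset.mem_biUnion, not_exists, not_and]
      exact fun M hM hvM => hv M (mem_moatsAt.1 hM).1 hvM
  have hrestrict : ∀ M : Finset V,
      ∑ U ∈ M.powerset with U ∈ s.moats, s.y U = ∑ U ∈ M.powerset, s.y U := by
    intro M
    refine Finset.sum_subset (Finset.filter_subset _ _) fun U hU hU' => h.y_zero U fun hUm => ?_
    exact hU' (Finset.mem_filter.2 ⟨hU, hUm⟩)
  have hy : ∑ M ∈ At, ∑ U ∈ M.powerset, s.y U ≤ ∑ U ∈ (I.mergedMoat s v).powerset, s.y U := by
    -- The empty set lies in every power set, hence the restriction to moats, which are nonempty.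
    simp only [← hrestrict]
    rw [← Finset.sum_biUnion]
    · refine Finset.sum_le_sum_of_subset_of_nonneg (fun U hU => ?_) fun U _ _ => h.y_nonneg U
      simp only [Finset.mem_biUnion, Finset.mem_filter, Finset.mem_powerset] at hU ⊢
      obtain ⟨M, hM, hUM, hUm⟩ := hU
      exact ⟨hUM.trans (subset_mergedMoat hM), hUm⟩
    · intro M hM M' hM' hne
      rw [Function.onFun, Finset.disjoint_left]
      intro U hU hU'
      simp only [Finset.mem_filter, Finset.mem_powerset] at hU hU'
      obtain ⟨x, hx⟩ := h.nonempty h₀ hU.2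
      exact hne (h.cur_eq (mem_moatsAt.1 hM).1 (mem_moatsAt.1 hM').1 (hU.1 hx) (hU'.1 hx))
  have hrest : ∑ M ∈ At.erase A, I.pen M ≤ ∑ M ∈ At.erase A, ∑ U ∈ M.powerset, s.y U :=
    Finset.sum_le_sum fun M hM => h.slack_inact M
      (hinact M (Finset.mem_of_mem_erase hM) (Finset.ne_of_mem_erase hM))
  have e1 := Finset.add_sum_erase At I.pen hA
  have e2 := Finset.add_sum_erase At (fun M => ∑ U ∈ M.powerset, s.y U) hA
  linarith

/-- The invariant survives a merge: the merged moat inherits its core from the unique active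
moat at `v`. -/
lemma ProcessInv.merge (h : I.ProcessInv 𝒞 Tr s) (h₀ : I.IsPhaseStart 𝒞 Tr) {v : V}
    (hv : I.TightEvent s v) (hroot : v ∉ I.nbrs Tr) (hload : ¬ I.LargeLoad 𝒞 s v) :
    I.ProcessInv 𝒞 Tr { s with
        act := insert (I.mergedMoat s v) (s.act \ I.moatsAt s v)
        inact := s.inact \ I.moatsAt s v
        moats := insert (I.mergedMoat s v) s.moats } := by
  obtain ⟨hvout, ⟨A, hA, hvA⟩, -⟩ := id hv
  set N := I.mergedMoat s v with hN
  have hAcur : A ∈ s.act ∪ s.inact := Finset.mem_union_left _ hA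
  have hAat : A ∈ I.moatsAt s v := mem_moatsAt.2 ⟨hAcur, hvA⟩
  have hvN : v ∈ N := mem_mergedMoat.2 (Or.inl rfl)
  have hNnew : N ∉ s.moats := fun hmem => h.not_mem_moat hvout hmem hvN
  obtain ⟨hvTr, hrpi⟩ := h.rpi_eq_zero h₀ hvout (h.act_sub hA) hvA
  -- The core of `A` has the current time as its age, which leaves less than half of it to the
  -- others.
  have hother : ∀ M ∈ I.moatsAt s v, M ≠ A →
      I.age s.time (I.coreOf 𝒞 M) < s.time / 2 := by
    intro M hM hne
    obtain ⟨hMcur, hvM⟩ := mem_moatsAt.1 hM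
    have := h.sum_age_loaders_lt hload hA hvA {I.coreOf 𝒞 M} fun C hC => by
      rw [Finset.mem_singleton] at hC
      exact ⟨fun heq => hne (h.cur_eq_of_core h₀ hMcur hAcur (hC ▸ heq)),
        M, h.cur_sub hMcur, hvM, hC.symm⟩
    simpa using this
  have htime : 0 < s.time := by
    have := h.sum_age_loaders_lt hload hA hvA ∅ (by simp)
    rw [Finset.sum_empty] at this
    linarith
  have hpen : ∀ M ∈ I.moatsAt s v, M ≠ A → I.pen (I.coreOf 𝒞 M) < s.time / 2 := by
    intro M hM hne
    rcases min_lt_iff.1 (hother M hM hne) with h1 | h1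
    · linarith
    · exact h1
  have hinact : ∀ M ∈ I.moatsAt s v, M ≠ A → M ∈ s.inact := by
    intro M hM hne
    rcases Finset.mem_union.1 (mem_moatsAt.1 hM).1 with hMa | hMi
    · have := h.le_act M hMa
      have := hpen M hM hne
      linarith
    · exact hMi
  have hleA := h.le_act A hA
  have hdom : I.IsDominant 𝒞 s.time N (I.coreOf 𝒞 A) := by
    have hdA := h.dom A (h.act_sub hA)
    refine ⟨hdA.mem, hdA.subset.trans (subset_mergedMoat hAat), fun D hD hDN hne => ?_⟩
    obtain ⟨M, hM, hDM⟩ := h.exists_moatsAt h₀ hvout (h.init_sub hD) hDN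
    by_cases hMA : M = A
    · subst hMA
      exact hdA.lt D hD hDM hne
    · have hp := hpen M hM hMA
      have hDle : I.pen D ≤ I.pen (I.coreOf 𝒞 M) := by
        by_cases hDC : D = I.coreOf 𝒞 M
        · rw [hDC]
        · exact ((h.dom M (h.cur_sub (mem_moatsAt.1 hM).1)).lt D hD hDM hDC).1.le
      constructor <;> linarith
  have hcore : I.coreOf 𝒞 N = I.coreOf 𝒞 A := hdom.coreOf_eq
  have hcur : ∀ M, M ∈ insert N (s.act \ I.moatsAt s v) ∪ s.inact \ I.moatsAt s v ↔
      M = N ∨ M ∈ s.act ∪ s.inact ∧ v ∉ I.nbrs M := by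
    intro M
    simp only [Finset.mem_union, Finset.mem_insert, Finset.mem_sdiff, mem_moatsAt]
    tauto
  have hdisjN : ∀ M ∈ s.act ∪ s.inact, v ∉ I.nbrs M → Disjoint N M := by
    intro M hM hvM
    rw [Finset.disjoint_left]
    intro x hxN hxM
    rcases mem_mergedMoat.1 hxN with rfl | ⟨M', hM', hxM'⟩
    · exact hvout M hM hxM
    · obtain rfl := h.cur_eq (mem_moatsAt.1 hM').1 hM hxM' hxM
      exact hvM (mem_moatsAt.1 hM').2
  have hnadjN : ∀ M ∈ s.act ∪ s.inact, v ∉ I.nbrs M → Disjoint N (I.nbrs M) := by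
    intro M hM hvM
    rw [Finset.disjoint_left]
    intro x hxN hxM
    rcases mem_mergedMoat.1 hxN with rfl | ⟨M', hM', hxM'⟩
    · exact hvM hxM
    · obtain ⟨hM'c, hvM'⟩ := mem_moatsAt.1 hM'
      have hne : M' ≠ M := fun heq => hvM (heq ▸ hvM')
      exact Finset.disjoint_left.1 (h.not_adj M' hM'c M hM hne) hxM' hxM
  have hrecord : I.MergeRecord 𝒞
      { s with
        act := insert N (s.act \ I.moatsAt s v)
        inact := s.inact \ I.moatsAt s v
        moats := insert N s.moats } N A v ((I.moatsAt s v).erase A) s.time :=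
    { eq := by
        rw [hN]
        ext x
        simp only [mem_mergedMoat, Finset.mem_insert, Finset.mem_union, Finset.mem_biUnion,
          Finset.mem_erase, id]
        constructor
        · rintro (hx | ⟨M, hM, hx⟩)
          · exact Or.inl hx
          · by_cases hMA : M = A
            · exact Or.inr (Or.inl (hMA ▸ hx))
            · exact Or.inr (Or.inr ⟨M, ⟨hMA, hM⟩, hx⟩)
        · rintro (hx | hx | ⟨M, ⟨-, hM⟩, hx⟩)
          · exact Or.inl hx
          · exact Or.inr ⟨A, hAat, hx⟩
          · exact Or.inr ⟨M, hM, hx⟩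
      mem_moats := Finset.mem_insert_of_mem (h.act_sub hA)
      core_eq := hcore
      not_everInact := h.act_not_ever A hA
      nbr := hvA
      everInact := fun D hD => by
        rw [Finset.mem_erase] at hD
        exact h.inact_sub (hinact D hD.2 hD.1)
      nbr' := fun D hD => (mem_moatsAt.1 (Finset.mem_of_mem_erase hD)).2
      disj := fun D hD => by
        rw [Finset.mem_erase] at hD
        exact h.disj A hAcur D (mem_moatsAt.1 hD.2).1 hD.1.symm
      not_adj := fun D hD => by
        rw [Finset.mem_erase] at hD
        exact h.not_adj A hAcur D (mem_moatsAt.1 hD.2).1 hD.1.symm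
      pairwise := fun D hD E hE hne => h.disj D (mem_moatsAt.1 (Finset.mem_of_mem_erase hD)).1 E
        (mem_moatsAt.1 (Finset.mem_of_mem_erase hE)).1 hne
      le_time := le_rfl
      le_core := hcore ▸ hleA
      half := fun D hD => by
        rw [Finset.mem_erase] at hD
        exact (hpen D hD.2 hD.1).le
      sub := fun R hR hRN => by
        have hR' : R ∈ s.moats := (Finset.mem_insert.1 hR).resolve_left hRN.ne
        obtain ⟨M, hM, hRM⟩ := h.exists_moatsAt h₀ hvout hR' hRN.subset
        by_cases hMA : M = A
        · exact Or.inl (hMA ▸ hRM)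
        · exact Or.inr ⟨M, Finset.mem_erase.2 ⟨hMA, hM⟩, hRM⟩
      load_le := by
        rw [hcore]
        exact h.load_sub_le hv hload hA hvA }
  exact
  { time_nonneg := h.time_nonneg
    y_nonneg := h.y_nonneg
    y_zero := fun S hS => h.y_zero S fun hS' => hS (Finset.mem_insert_of_mem hS')
    act_sub := Finset.insert_subset_insert _ (Finset.sdiff_subset.trans h.act_sub)
    inact_sub := Finset.sdiff_subset.trans h.inact_sub
    ever_sub := h.ever_sub.trans (Finset.subset_insert _ _)
    act_not_ever := fun S hS => by
      rcases Finset.mem_insert.1 hS with rfl | hS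
      · exact fun hmem => hNnew (h.ever_sub hmem)
      · exact h.act_not_ever S (Finset.mem_sdiff.1 hS).1
    init_sub := h.init_sub.trans (Finset.subset_insert _ _)
    disj := fun S hS M hM hne => by
      rcases (hcur S).1 hS with rfl | ⟨hS, hvS⟩ <;> rcases (hcur M).1 hM with rfl | ⟨hM, hvM⟩
      · exact absurd rfl hne
      · exact hdisjN M hM hvM
      · exact (hdisjN S hS hvS).symm
      · exact h.disj S hS M hM hne
    not_adj := fun S hS M hM hne => by
      rcases (hcur S).1 hS with rfl | ⟨hS, hvS⟩ <;> rcases (hcur M).1 hM with rfl | ⟨hM, hvM⟩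
      · exact absurd rfl hne
      · exact hnadjN M hM hvM
      · rw [Finset.disjoint_left]
        intro x hxS hx
        obtain ⟨w, hw, hwx⟩ := (mem_nbrs.1 hx).2
        exact Finset.disjoint_left.1 (hnadjN S hS hvS) hw (mem_nbrs.2
          ⟨Finset.disjoint_left.1 (hdisjN S hS hvS) hw, x, hxS, hwx.symm⟩)
      · exact h.not_adj S hS M hM hne
    sub_cur := fun R hR => by
      rcases Finset.mem_insert.1 hR with rfl | hR
      · exact ⟨_, (hcur _).2 (Or.inl rfl), subset_rfl⟩
      · obtain ⟨M, hM, hRM⟩ := h.sub_cur R hR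
        by_cases hvM : v ∈ I.nbrs M
        · exact ⟨N, (hcur N).2 (Or.inl rfl),
            hRM.trans (subset_mergedMoat (mem_moatsAt.2 ⟨hM, hvM⟩))⟩
        · exact ⟨M, (hcur M).2 (Or.inr ⟨hM, hvM⟩), hRM⟩
    disj_root := fun S hS => by
      rcases Finset.mem_insert.1 hS with rfl | hS
      · rw [Finset.disjoint_left]
        intro x hx
        rcases mem_mergedMoat.1 hx with rfl | ⟨M, hM, hxM⟩
        · exact hvTr
        · exact Finset.disjoint_left.1 (h.disj_root M (h.cur_sub (mem_moatsAt.1 hM).1)) hxM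
      · exact h.disj_root S hS
    not_adj_root := fun S hS => by
      rcases Finset.mem_insert.1 hS with rfl | hS
      · rw [Finset.disjoint_left]
        intro x hx
        rcases mem_mergedMoat.1 hx with rfl | ⟨M, hM, hxM⟩
        · exact hroot
        · exact Finset.disjoint_left.1 (h.not_adj_root M (h.cur_sub (mem_moatsAt.1 hM).1)) hxM
      · exact h.not_adj_root S hS
    dom := fun S hS => by
      rcases Finset.mem_insert.1 hS with rfl | hS
      · rw [hcore]; exact hdom
      · exact h.dom S hS
    slack_act := fun S hS => by
      rcases Finset.mem_insert.1 hS with rfl | hS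
      · have h1 := h.slack_mergedMoat h₀ hvout hrpi hAat hinact
        have h2 := h.slack_act A hA
        rw [hcore]
        exact h1.trans h2
      · exact h.slack_act S (Finset.mem_sdiff.1 hS).1
    le_act := fun S hS => by
      rcases Finset.mem_insert.1 hS with rfl | hS
      · rw [hcore]; exact hleA
      · exact h.le_act S (Finset.mem_sdiff.1 hS).1
    slack_inact := fun S hS => h.slack_inact S (Finset.mem_sdiff.1 hS).1
    dual_le_time := h.dual_le_time
    dual_le_pen := h.dual_le_pen
    record := fun S hS => by
      rcases Finset.mem_insert.1 hS with rfl | hS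
      · exact Or.inr ⟨_, _, _, _, hrecord⟩
      · rcases h.record S hS with hS' | ⟨B, u, 𝒟, t, hr⟩
        · exact Or.inl hS'
        · refine Or.inr ⟨B, u, 𝒟, t, hr.mono (Finset.subset_insert _ _) (fun R hR hRS => ?_)
            subset_rfl hr.not_everInact le_rfl fun _ _ _ => rfl⟩
          refine (Finset.mem_insert.1 hR).resolve_left ?_
          rintro rfl
          exact h.not_mem_moat hvout hS (hRS.subset hvN) }

theorem Reaches.processInv (hs : I.Reaches 𝒞 Tr s) (h₀ : I.IsPhaseStart 𝒞 Tr) :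
    I.ProcessInv 𝒞 Tr s := by
  induction hs with
  | start => exact h₀.processInv
  | grow s ε _ hε _ _ hpen ih => exact ih.grow h₀ hε hpen
  | deactivate s S _ hS htight ih => exact ih.deactivate h₀ hS htight
  | merge s v _ hv hroot hload ih => exact ih.merge h₀ hv hroot hload

end Merge


/-! ### Super-vertices -/

lemma mem_superVertices [DecidableEq V] {s : DualState V} {S R : Finset V} : R ∈ superVertices s S ↔
    R ∈ s.everInact ∧ R ⊂ S ∧ ∀ R' ∈ s.everInact, R' ⊂ S → R ⊆ R' → R' = R := by
  simp [superVertices]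

lemma subset_of_superVertex [DecidableEq V] {s : DualState V} {S R : Finset V}
    (hR : R ∈ superVertices s S) : R ⊆ S :=
  (mem_superVertices.1 hR).2.1.subset

section SuperVertices

variable [Fintype V] {I : NWPCST V} {𝒞 : Finset (Finset V)} {Tr : Finset V} [DecidableEq V]
  {s : DualState V}

/-- Induction along the merges in which a moat keeps its core. -/
lemma ProcessInv.moat_induction (h : I.ProcessInv 𝒞 Tr s) {P : Finset V → Prop}
    (init : ∀ C ∈ 𝒞, P C)
    (merge : ∀ S A v 𝒟 t, S ∈ s.moats → I.MergeRecord 𝒞 s S A v 𝒟 t → P A → P S) :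
    ∀ S ∈ s.moats, P S := by
  intro S
  induction S using Finset.strongInduction with
  | H S ih =>
    intro hS
    rcases h.record S hS with hS' | ⟨A, v, 𝒟, t, hr⟩
    · exact init S hS'
    · exact merge S A v 𝒟 t hS hr (ih A hr.ssubset hr.mem_moats)

lemma ProcessInv.mem_moats_of_superVertex (h : I.ProcessInv 𝒞 Tr s) {S R : Finset V}
    (hR : R ∈ superVertices s S) : R ∈ s.moats :=
  h.ever_sub (mem_superVertices.1 hR).1

lemma ProcessInv.not_superVertex_init (h : I.ProcessInv 𝒞 Tr s) (h₀ : I.IsPhaseStart 𝒞 Tr)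
    {C R : Finset V} (hC : C ∈ 𝒞) : R ∉ superVertices s C := by
  intro hR
  have hRm := h.mem_moats_of_superVertex hR
  have hRC := (mem_superVertices.1 hR).2.1
  have : I.coreOf 𝒞 R = C :=
    h₀.eq_of_subset hC (h.coreOf_mem hRm) ((h.coreOf_subset hRm).trans hRC.subset)
  exact hRC.not_subset (this ▸ h.coreOf_subset hRm)

/-- The super-vertices of a merged moat are those of the active moat `A` that takes part in the
merge, together with the inactive moats that do. -/
lemma ProcessInv.mem_superVertices_iff (h : I.ProcessInv 𝒞 Tr s) (h₀ : I.IsPhaseStart 𝒞 Tr)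
    {S A R : Finset V} {v : V} {𝒟 : Finset (Finset V)} {t : ℝ}
    (hr : I.MergeRecord 𝒞 s S A v 𝒟 t) :
    R ∈ superVertices s S ↔ R ∈ superVertices s A ∨ R ∈ 𝒟 := by
  constructor
  · intro hR
    obtain ⟨hRe, hRS, hmax⟩ := mem_superVertices.1 hR
    rcases hr.sub R (h.ever_sub hRe) hRS with hRA | ⟨D, hD, hRD⟩
    · have hne : R ≠ A := fun heq => hr.not_everInact (heq ▸ hRe)
      exact Or.inl (mem_superVertices.2 ⟨hRe, hRA.ssubset_of_ne hne, fun R' hR' hR'A hRR' =>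
        hmax R' hR' (hR'A.trans hr.ssubset) hRR'⟩)
    · rw [← hmax D (hr.everInact D hD) (hr.ssubset' hD) hRD]
      exact Or.inr hD
  · rintro (hR | hR)
    · obtain ⟨hRe, hRA, hmax⟩ := mem_superVertices.1 hR
      refine mem_superVertices.2 ⟨hRe, hRA.trans hr.ssubset, fun R' hR' hR'S hRR' => ?_⟩
      rcases hr.sub R' (h.ever_sub hR') hR'S with hR'A | ⟨D, hD, hR'D⟩
      · have hne : R' ≠ A := fun heq => hr.not_everInact (heq ▸ hR')
        exact hmax R' hR' (hR'A.ssubset_of_ne hne) hRR'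
      · obtain ⟨x, hx⟩ := h.nonempty h₀ (h.ever_sub hRe)
        exact absurd (hR'D (hRR' hx)) (Finset.disjoint_left.1 (hr.disj D hD) (hRA.subset hx))
    · refine mem_superVertices.2 ⟨hr.everInact R hR, hr.ssubset' hR, fun R' hR' hR'S hRR' => ?_⟩
      obtain ⟨x, hx⟩ := h.nonempty h₀ (h.ever_sub (hr.everInact R hR))
      rcases hr.sub R' (h.ever_sub hR') hR'S with hR'A | ⟨D, hD, hR'D⟩
      · exact absurd hx (Finset.disjoint_left.1 (hr.disj R hR) (hR'A (hRR' hx)))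
      · have : R = D := by
          by_contra hne
          exact Finset.disjoint_left.1 (hr.pairwise R hR D hD hne) hx (hR'D (hRR' hx))
        exact (this ▸ hR'D).antisymm hRR'

/-- Super-vertices are disjoint from the core and not adjacent to it, and their cores are at most
half as old. -/
lemma ProcessInv.superVertex_core (h : I.ProcessInv 𝒞 Tr s) (h₀ : I.IsPhaseStart 𝒞 Tr) :
    ∀ S ∈ s.moats, ∀ R ∈ superVertices s S, Disjoint (I.coreOf 𝒞 S) R ∧
      Disjoint (I.coreOf 𝒞 S) (I.nbrs R) ∧
      2 * I.age s.time (I.coreOf 𝒞 R) ≤ I.age s.time (I.coreOf 𝒞 S) := by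
  refine h.moat_induction (fun C hC R hR => absurd hR (h.not_superVertex_init h₀ hC)) ?_
  intro S A v 𝒟 t hS hr ih R hR
  rcases (h.mem_superVertices_iff h₀ hr).1 hR with hR | hR
  · rw [hr.core_eq]
    exact ih R hR
  · have hsub : I.coreOf 𝒞 S ⊆ A := hr.core_eq ▸ h.coreOf_subset hr.mem_moats
    refine ⟨(hr.disj R hR).mono_left hsub, (hr.not_adj R hR).mono_left hsub, ?_⟩
    have h1 := hr.half R hR
    have h2 : t ≤ I.age s.time (I.coreOf 𝒞 S) := le_min hr.le_time hr.le_core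
    have h3 : I.age s.time (I.coreOf 𝒞 R) ≤ I.pen (I.coreOf 𝒞 R) := min_le_right _ _
    linarith

lemma ProcessInv.superVertex_disjoint (h : I.ProcessInv 𝒞 Tr s) (h₀ : I.IsPhaseStart 𝒞 Tr) :
    ∀ S ∈ s.moats, ∀ R ∈ superVertices s S, ∀ R' ∈ superVertices s S, R ≠ R' → Disjoint R R' := by
  refine h.moat_induction (fun C hC R hR => absurd hR (h.not_superVertex_init h₀ hC)) ?_
  intro S A v 𝒟 t hS hr ih R hR R' hR' hne
  rcases (h.mem_superVertices_iff h₀ hr).1 hR with hR | hR <;>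
    rcases (h.mem_superVertices_iff h₀ hr).1 hR' with hR' | hR'
  · exact ih R hR R' hR' hne
  · exact (hr.disj R' hR').mono_left (subset_of_superVertex hR)
  · exact ((hr.disj R hR).mono_left (subset_of_superVertex hR')).symm
  · exact hr.pairwise R hR R' hR' hne

/-- The core of a moat lies in none of its super-vertices. -/
lemma ProcessInv.core_not_subset_superVertex (h : I.ProcessInv 𝒞 Tr s)
    (h₀ : I.IsPhaseStart 𝒞 Tr) {S R : Finset V} (hS : S ∈ s.moats)
    (hR : R ∈ superVertices s S) : ¬ I.coreOf 𝒞 S ⊆ R := by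
  intro hsub
  obtain ⟨x, hx⟩ := h₀.nonempty (h.coreOf_mem hS)
  exact Finset.disjoint_left.1 (h.superVertex_core h₀ S hS R hR).1 hx (hsub hx)

/-- A moat with the same core strictly inside a merged moat is part of the active moat that took
part in the merge. -/
lemma MergeRecord.subset_of_core {S A R : Finset V} {v : V} {𝒟 : Finset (Finset V)} {t : ℝ}
    (hr : I.MergeRecord 𝒞 s S A v 𝒟 t) (h : I.ProcessInv 𝒞 Tr s) (h₀ : I.IsPhaseStart 𝒞 Tr)
    (hR : R ∈ s.moats) (hRS : R ⊂ S) (hcore : I.coreOf 𝒞 R = I.coreOf 𝒞 S) : R ⊆ A := by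
  rcases hr.sub R hR hRS with hRA | ⟨D, hD, hRD⟩
  · exact hRA
  · obtain ⟨x, hx⟩ := h₀.nonempty (h.coreOf_mem hR)
    refine absurd (hRD (h.coreOf_subset hR hx)) (Finset.disjoint_left.1 (hr.disj D hD) ?_)
    rw [hcore, hr.core_eq] at hx
    exact h.coreOf_subset hr.mem_moats hx

lemma ProcessInv.core_chain (h : I.ProcessInv 𝒞 Tr s) (h₀ : I.IsPhaseStart 𝒞 Tr) :
    ∀ S ∈ s.moats, ∀ R ∈ s.moats, R ⊆ S → I.coreOf 𝒞 R = I.coreOf 𝒞 S →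
      ∀ R' ∈ s.moats, R' ⊆ S → I.coreOf 𝒞 R' = I.coreOf 𝒞 S → R ⊆ R' ∨ R' ⊆ R := by
  refine h.moat_induction ?_ ?_
  · intro C hC R hR hRC hcore R' hR' hR'C hcore'
    rw [h₀.coreOf_eq hC] at hcore
    exact Or.inr (hR'C.trans (hcore ▸ h.coreOf_subset hR))
  · intro S A v 𝒟 t hS hr ih R hR hRS hcore R' hR' hR'S hcore'
    by_cases hRe : R = S
    · exact Or.inr (hRe ▸ hR'S)
    by_cases hRe' : R' = S
    · exact Or.inl (hRe' ▸ hRS)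
    exact ih R hR (hr.subset_of_core h h₀ hR (hRS.ssubset_of_ne hRe) hcore)
      (hcore.trans hr.core_eq) R' hR'
      (hr.subset_of_core h h₀ hR' (hR'S.ssubset_of_ne hRe') hcore') (hcore'.trans hr.core_eq)

/-- If `R ⊆ S` are moats with the same core, then the super-vertices of `R` are those super-vertices
of `S` that intersect `R`. -/
lemma ProcessInv.superVertex_of_core (h : I.ProcessInv 𝒞 Tr s) (h₀ : I.IsPhaseStart 𝒞 Tr) :
    ∀ S ∈ s.moats, ∀ R ∈ s.moats, R ⊆ S → I.coreOf 𝒞 R = I.coreOf 𝒞 S →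
      (∀ D ∈ superVertices s R, D ∈ superVertices s S) ∧
      ∀ D ∈ superVertices s S, ∀ x ∈ D, x ∈ R → D ∈ superVertices s R := by
  refine h.moat_induction ?_ ?_
  · intro C hC R hR hRC hcore
    rw [h₀.coreOf_eq hC] at hcore
    obtain rfl : R = C := hRC.antisymm (hcore ▸ h.coreOf_subset hR)
    exact ⟨fun _ hD => hD, fun _ hD _ _ _ => hD⟩
  · intro S A v 𝒟 t hS hr ih R hR hRS hcore
    by_cases hRe : R = S
    · subst hRe
      exact ⟨fun _ hD => hD, fun _ hD _ _ _ => hD⟩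
    have hRA := hr.subset_of_core h h₀ hR (hRS.ssubset_of_ne hRe) hcore
    obtain ⟨ih1, ih2⟩ := ih R hR hRA (hcore.trans hr.core_eq)
    refine ⟨fun D hD => (h.mem_superVertices_iff h₀ hr).2 (Or.inl (ih1 D hD)),
      fun D hD x hxD hxR => ?_⟩
    rcases (h.mem_superVertices_iff h₀ hr).1 hD with hD | hD
    · exact ih2 D hD x hxD hxR
    · exact absurd hxD (Finset.disjoint_left.1 (hr.disj D hD) (hRA hxR))

/-- The centre of a merge lies in no super-vertex. -/
lemma MergeRecord.not_mem_superVertex {S A R : Finset V} {v : V} {𝒟 : Finset (Finset V)} {t : ℝ}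
    (hr : I.MergeRecord 𝒞 s R A v 𝒟 t) (h : I.ProcessInv 𝒞 Tr s) (h₀ : I.IsPhaseStart 𝒞 Tr)
    (hS : S ∈ s.moats) (hR : R ∈ s.moats) (hRS : R ⊆ S)
    (hcore : I.coreOf 𝒞 R = I.coreOf 𝒞 S) {D : Finset V} (hD : D ∈ superVertices s S) :
    v ∉ D := by
  intro hvD
  have hDR := (h.superVertex_of_core h₀ S hS R hR hRS hcore).2 D hD v hvD hr.mem
  rcases (h.mem_superVertices_iff h₀ hr).1 hDR with hDA | hDD
  · exact (mem_nbrs.1 hr.nbr).1 (subset_of_superVertex hDA hvD)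
  · exact (mem_nbrs.1 (hr.nbr' D hDD)).1 hvD

/-! ### Auxiliary costs -/

lemma coreLoad_mono (h : I.ProcessInv 𝒞 Tr s) {R S : Finset V} (hRS : R ⊆ S) (C : Finset V)
    (x : V) : I.coreLoad 𝒞 s.y R C x ≤ I.coreLoad 𝒞 s.y S C x := by
  refine Finset.sum_le_sum_of_subset_of_nonneg (fun U hU => ?_) fun U _ _ => h.y_nonneg U
  simp only [Finset.mem_filter, Finset.mem_powerset] at hU ⊢
  exact ⟨hU.1.trans hRS, hU.2⟩

lemma ProcessInv.coreLoad_nonneg (h : I.ProcessInv 𝒞 Tr s) (S C : Finset V) (x : V) :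
    0 ≤ I.coreLoad 𝒞 s.y S C x :=
  Finset.sum_nonneg fun U _ => h.y_nonneg U

lemma ProcessInv.auxCost_eq (h : I.ProcessInv 𝒞 Tr s) (S : Finset V) {C : Finset V} {x : V}
    (hx : x ∉ C) : I.auxCost 𝒞 s S C x = I.coreLoad 𝒞 s.y S C x := by
  classical
  rw [auxCost, if_neg hx, coreLoad, Finset.sum_filter, Finset.sum_filter]
  refine Finset.sum_congr rfl fun R _ => ?_
  by_cases hR : R ∈ s.moats
  · simp only [(h.dom R hR).isCore_iff, eq_comm]
  · simp [h.y_zero R hR]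

lemma ProcessInv.auxCost_nonneg (h : I.ProcessInv 𝒞 Tr s) (S C : Finset V) (x : V) :
    0 ≤ I.auxCost 𝒞 s S C x := by
  unfold auxCost
  split_ifs
  · exact le_rfl
  · exact Finset.sum_nonneg fun R _ => h.y_nonneg R

lemma ProcessInv.auxCost_le (h : I.ProcessInv 𝒞 Tr s) (S C : Finset V) (x : V) :
    I.auxCost 𝒞 s S C x ≤ I.coreLoad 𝒞 s.y S C x := by
  by_cases hx : x ∈ C
  · rw [auxCost, if_pos hx]
    exact h.coreLoad_nonneg S C x
  · exact (h.auxCost_eq S hx).le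

lemma ProcessInv.auxVertexCost_nonneg (h : I.ProcessInv 𝒞 Tr s) (S C : Finset V)
    (a : AuxVertex V) : 0 ≤ I.auxVertexCost 𝒞 s S C a := by
  cases a
  · exact h.auxCost_nonneg S C _
  · exact le_rfl

/-- An original vertex of `H_S` inside `S` but outside the core was the centre of a merge, so its
non-auxiliary cost is at most half the age of the core. -/
lemma ProcessInv.rc_sub_auxCost_le (h : I.ProcessInv 𝒞 Tr s) (h₀ : I.IsPhaseStart 𝒞 Tr)
    {S : Finset V} (hS : S ∈ s.moats) {x : V} (hxS : x ∈ S) (hxC : x ∉ I.coreOf 𝒞 S)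
    (hxR : ∀ R ∈ superVertices s S, x ∉ R) :
    I.rc x - I.auxCost 𝒞 s S (I.coreOf 𝒞 S) x ≤ I.age s.time (I.coreOf 𝒞 S) / 2 := by
  rw [h.auxCost_eq S hxC]
  revert hxS hxC hxR
  refine h.moat_induction (P := fun S => x ∈ S → x ∉ I.coreOf 𝒞 S →
    (∀ R ∈ superVertices s S, x ∉ R) → I.rc x - I.coreLoad 𝒞 s.y S (I.coreOf 𝒞 S) x ≤
      I.age s.time (I.coreOf 𝒞 S) / 2) ?_ ?_ S hS
  · intro C hC hxC hxC'
    rw [h₀.coreOf_eq hC] at hxC'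
    exact absurd hxC hxC'
  · intro S A v 𝒟 t hS hr ih hxS hxC hxR
    have hage : t ≤ I.age s.time (I.coreOf 𝒞 S) := le_min hr.le_time hr.le_core
    rw [hr.eq, Finset.mem_insert, Finset.mem_union, Finset.mem_biUnion] at hxS
    rcases hxS with rfl | hxA | ⟨D, hD, hxD⟩
    · have := hr.load_le
      linarith
    · have h1 := ih hxA (hr.core_eq ▸ hxC)
        fun R hR => hxR R ((h.mem_superVertices_iff h₀ hr).2 (Or.inl hR))
      have h2 := coreLoad_mono h hr.subset (I.coreOf 𝒞 S) x
      rw [← hr.core_eq] at h1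
      linarith
    · exact absurd hxD (hxR D ((h.mem_superVertices_iff h₀ hr).2 (Or.inr hD)))

/-- The dual value of the sets with core `C` inside `R`. -/
noncomputable def coreDualIn (I : NWPCST V) (𝒞 : Finset (Finset V)) (y : Finset V → ℝ)
    (R C : Finset V) : ℝ :=
  ∑ U ∈ R.powerset.filter (fun U => I.coreOf 𝒞 U = C), y U

/-- The part of `coreDualIn` that the vertex `x` does not feel. -/
noncomputable def coreUnfelt (I : NWPCST V) (𝒞 : Finset (Finset V)) (y : Finset V → ℝ)
    (R C : Finset V) (x : V) : ℝ :=
  ∑ U ∈ R.powerset.filter (fun U => x ∉ I.nbrs U ∧ I.coreOf 𝒞 U = C), y U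

lemma coreLoad_add_coreUnfelt (y : Finset V → ℝ) (R C : Finset V) (x : V) :
    I.coreLoad 𝒞 y R C x + I.coreUnfelt 𝒞 y R C x = I.coreDualIn 𝒞 y R C := by
  unfold coreLoad coreUnfelt coreDualIn
  rw [← Finset.sum_filter_add_sum_filter_not (R.powerset.filter fun U => I.coreOf 𝒞 U = C)
    (fun U => x ∈ I.nbrs U), Finset.filter_filter, Finset.filter_filter]
  simp only [and_comm]

lemma ProcessInv.coreDualIn_mono (h : I.ProcessInv 𝒞 Tr s) {R S : Finset V} (hRS : R ⊆ S)
    (C : Finset V) : I.coreDualIn 𝒞 s.y R C ≤ I.coreDualIn 𝒞 s.y S C := by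
  refine Finset.sum_le_sum_of_subset_of_nonneg (fun U hU => ?_) fun U _ _ => h.y_nonneg U
  simp only [Finset.mem_filter, Finset.mem_powerset] at hU ⊢
  exact ⟨hU.1.trans hRS, hU.2⟩

lemma ProcessInv.coreDualIn_nonneg (h : I.ProcessInv 𝒞 Tr s) (R C : Finset V) :
    0 ≤ I.coreDualIn 𝒞 s.y R C :=
  Finset.sum_nonneg fun U _ => h.y_nonneg U

lemma ProcessInv.coreDualIn_le_age (h : I.ProcessInv 𝒞 Tr s) (R C : Finset V) :
    I.coreDualIn 𝒞 s.y R C ≤ I.age s.time C := by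
  refine le_trans ?_ (h.coreDual_le_age C)
  refine Finset.sum_le_sum_of_subset_of_nonneg (fun U hU => ?_) fun U _ _ => h.y_nonneg U
  simp only [Finset.mem_filter, Finset.mem_univ, true_and] at hU ⊢
  exact hU.2

lemma ProcessInv.coreUnfelt_nonneg (h : I.ProcessInv 𝒞 Tr s) (R C : Finset V) (x : V) :
    0 ≤ I.coreUnfelt 𝒞 s.y R C x :=
  Finset.sum_nonneg fun U _ => h.y_nonneg U

lemma ProcessInv.coreUnfelt_mono (h : I.ProcessInv 𝒞 Tr s) {R S : Finset V} (hRS : R ⊆ S)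
    (C : Finset V) (x : V) : I.coreUnfelt 𝒞 s.y R C x ≤ I.coreUnfelt 𝒞 s.y S C x := by
  refine Finset.sum_le_sum_of_subset_of_nonneg (fun U hU => ?_) fun U _ _ => h.y_nonneg U
  simp only [Finset.mem_filter, Finset.mem_powerset] at hU ⊢
  exact ⟨hU.1.trans hRS, hU.2⟩

/-- A vertex outside `S` that does not neighbour the part `A` of `S` feels nothing from inside `A`.
-/
lemma ProcessInv.coreDualIn_le_coreUnfelt (h : I.ProcessInv 𝒞 Tr s) {A S : Finset V}
    (hAS : A ⊆ S) (C : Finset V) {x : V} (hxS : x ∉ S) (hxA : x ∉ I.nbrs A) :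
    I.coreDualIn 𝒞 s.y A C ≤ I.coreUnfelt 𝒞 s.y S C x := by
  refine Finset.sum_le_sum_of_subset_of_nonneg (fun U hU => ?_) fun U _ _ => h.y_nonneg U
  simp only [Finset.mem_filter, Finset.mem_powerset] at hU ⊢
  refine ⟨hU.1.trans hAS, fun hxU => hxA ?_, hU.2⟩
  obtain ⟨w, hw, hwx⟩ := (mem_nbrs.1 hxU).2
  exact mem_nbrs.2 ⟨fun hx => hxS (hAS hx), w, hU.1 hw, hwx⟩

/-- The load that the centre of a merge feels from the core of `S` is all felt from inside the
active moat that took part in the merge. -/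
lemma MergeRecord.coreLoad_le {S A R : Finset V} {v : V} {𝒟 : Finset (Finset V)} {t : ℝ}
    (hr : I.MergeRecord 𝒞 s R A v 𝒟 t) (h : I.ProcessInv 𝒞 Tr s) (h₀ : I.IsPhaseStart 𝒞 Tr)
    (hS : S ∈ s.moats) (hR : R ∈ s.moats) (hRS : R ⊆ S)
    (hcore : I.coreOf 𝒞 R = I.coreOf 𝒞 S) :
    I.coreLoad 𝒞 s.y S (I.coreOf 𝒞 S) v ≤ I.coreLoad 𝒞 s.y A (I.coreOf 𝒞 S) v := by
  have hrestrict : I.coreLoad 𝒞 s.y S (I.coreOf 𝒞 S) v =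
      ∑ U ∈ (S.powerset.filter fun U => v ∈ I.nbrs U ∧ I.coreOf 𝒞 U = I.coreOf 𝒞 S) with
        U ∈ s.moats, s.y U := by
    refine (Finset.sum_subset (Finset.filter_subset _ _)
      fun U hU hU' => h.y_zero U fun hUm => ?_).symm
    exact hU' (Finset.mem_filter.2 ⟨hU, hUm⟩)
  rw [hrestrict]
  refine Finset.sum_le_sum_of_subset_of_nonneg (fun U hU => ?_) fun U _ _ => h.y_nonneg U
  simp only [Finset.mem_filter, Finset.mem_powerset] at hU ⊢
  obtain ⟨⟨hUS, hvU, hUC⟩, hUm⟩ := hU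
  refine ⟨?_, hvU, hUC⟩
  have hvU' := (mem_nbrs.1 hvU).1
  have hUR : U ⊆ R := (h.core_chain h₀ S hS R hR hRS hcore U hUm hUS hUC).resolve_left
    fun hRU => hvU' (hRU hr.mem)
  have hne : U ≠ R := fun heq => hvU' (heq ▸ hr.mem)
  exact hr.subset_of_core h h₀ hUm (hUR.ssubset_of_ne hne) (hUC.trans hcore.symm)

end SuperVertices


/-! ### Cheap walks in the auxiliary graphs -/

lemma isAuxVertex_of_mem_support [DecidableEq V] {I : NWPCST V} {s : DualState V} {S X : Finset V}
    {a b : AuxVertex V} (p : (I.auxGraph s S X).Walk a b) (ha : IsAuxVertex s S X a) :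
    ∀ n ∈ p.support, IsAuxVertex s S X n := by
  induction p with
  | nil =>
    intro n hn
    rw [SimpleGraph.Walk.support_nil, List.mem_singleton] at hn
    exact hn ▸ ha
  | cons hadj p ih =>
    intro n hn
    rw [SimpleGraph.Walk.support_cons, List.mem_cons] at hn
    rcases hn with rfl | hn
    · exact ha
    · exact ih hadj.2.2.1 n hn

section Walks

variable [Fintype V] {I : NWPCST V} {𝒞 : Finset (Finset V)} {Tr : Finset V} [DecidableEq V]
  {s : DualState V}

/-- In `H_S` there is a walk from `a` to `b` of auxiliary cost at most `w`. -/
def AuxReach (I : NWPCST V) (𝒞 : Finset (Finset V)) (s : DualState V) (S C X : Finset V)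
    (a b : AuxVertex V) (w : ℝ) : Prop :=
  ∃ p : (I.auxGraph s S X).Walk a b, I.pathCost 𝒞 s S C p ≤ w

variable {S C X : Finset V} {a b c : AuxVertex V} {w w' : ℝ}

lemma AuxReach.mono (h : I.AuxReach 𝒞 s S C X a b w) (hw : w ≤ w') :
    I.AuxReach 𝒞 s S C X a b w' :=
  ⟨h.choose, h.choose_spec.trans hw⟩

lemma AuxReach.refl (a : AuxVertex V) (hw : I.auxVertexCost 𝒞 s S C a ≤ w) :
    I.AuxReach 𝒞 s S C X a a w :=
  ⟨.nil, by simpa [pathCost] using hw⟩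

lemma AuxReach.cons (hadj : (I.auxGraph s S X).Adj a b) (h : I.AuxReach 𝒞 s S C X b c w) :
    I.AuxReach 𝒞 s S C X a c (I.auxVertexCost 𝒞 s S C a + w) := by
  obtain ⟨p, hp⟩ := h
  refine ⟨.cons hadj p, ?_⟩
  unfold pathCost at hp ⊢
  rw [SimpleGraph.Walk.support_cons, List.map_cons, List.sum_cons]
  linarith

lemma AuxReach.symm (h : I.AuxReach 𝒞 s S C X a b w) : I.AuxReach 𝒞 s S C X b a w := by
  obtain ⟨p, hp⟩ := h
  refine ⟨p.reverse, ?_⟩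
  unfold pathCost at hp ⊢
  rwa [SimpleGraph.Walk.support_reverse, List.map_reverse, List.sum_reverse]

lemma AuxReach.trans (hs : I.ProcessInv 𝒞 Tr s) (h : I.AuxReach 𝒞 s S C X a b w)
    (h' : I.AuxReach 𝒞 s S C X b c w') : I.AuxReach 𝒞 s S C X a c (w + w') := by
  obtain ⟨p, hp⟩ := h
  obtain ⟨p', hp'⟩ := h'
  refine ⟨p.append p', ?_⟩
  unfold pathCost at hp hp' ⊢
  rw [SimpleGraph.Walk.support_append, List.map_append, List.sum_append]
  have : (p'.support.tail.map (I.auxVertexCost 𝒞 s S C)).sum ≤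
      (p'.support.map (I.auxVertexCost 𝒞 s S C)).sum := by
    refine List.Sublist.sum_le_sum ((List.tail_sublist _).map _) fun x hx => ?_
    obtain ⟨n, -, rfl⟩ := List.mem_map.1 hx
    exact hs.auxVertexCost_nonneg S C n
  linarith

lemma AuxReach.exists_isPath (hs : I.ProcessInv 𝒞 Tr s) (h : I.AuxReach 𝒞 s S C X a b w) :
    ∃ p : (I.auxGraph s S X).Walk a b, p.IsPath ∧ I.pathCost 𝒞 s S C p ≤ w := by
  classical
  obtain ⟨p, hp⟩ := h
  refine ⟨p.bypass, p.bypass_isPath, le_trans ?_ hp⟩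
  refine List.Sublist.sum_le_sum (p.support_bypass_sublist_support.map _) fun x hx => ?_
  obtain ⟨n, -, rfl⟩ := List.mem_map.1 hx
  exact hs.auxVertexCost_nonneg S C n

lemma pathCost_concat_super {R : Finset V} (p : (I.auxGraph s S X).Walk a b)
    (hadj : (I.auxGraph s S X).Adj b (.super R)) :
    I.pathCost 𝒞 s S C (p.concat hadj) = I.pathCost 𝒞 s S C p := by
  simp [pathCost, SimpleGraph.Walk.support_concat, auxVertexCost]

lemma ProcessInv.isAuxVertex_core (h : I.ProcessInv 𝒞 Tr s) (h₀ : I.IsPhaseStart 𝒞 Tr)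
    (hS : S ∈ s.moats) {x : V} (hx : x ∈ I.coreOf 𝒞 S) : IsAuxVertex s S X (.orig x) :=
  ⟨Finset.mem_union_left _ (h.coreOf_subset hS hx), fun R hR =>
    Finset.disjoint_left.1 (h.superVertex_core h₀ S hS R hR).1 hx⟩

/-- The core is connected and its vertices have auxiliary cost zero. -/
lemma ProcessInv.auxReach_core (h : I.ProcessInv 𝒞 Tr s) (h₀ : I.IsPhaseStart 𝒞 Tr)
    (hS : S ∈ s.moats) {x x' : V} (hx : x ∈ I.coreOf 𝒞 S) (hx' : x' ∈ I.coreOf 𝒞 S) :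
    I.AuxReach 𝒞 s S (I.coreOf 𝒞 S) X (.orig x) (.orig x') 0 := by
  have hconn := h₀.connected _ (h.coreOf_mem hS)
  obtain ⟨p⟩ := hconn.preconnected ⟨x, hx⟩ ⟨x', hx'⟩
  let f : I.G.induce (I.coreOf 𝒞 S : Set V) →g I.auxGraph s S X :=
    { toFun := fun u => .orig u.1
      map_rel' := fun {u u'} huu' => by
        refine ⟨fun heq => ?_, h.isAuxVertex_core h₀ hS u.2, h.isAuxVertex_core h₀ hS u'.2,
          u.1, by simp [AuxVertex.verts], u'.1, by simp [AuxVertex.verts], huu'⟩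
        injection heq with heq
        exact huu'.ne (Subtype.ext heq) }
  refine ⟨p.map f, le_of_eq (List.sum_eq_zero fun y hy => ?_)⟩
  rw [SimpleGraph.Walk.support_map, List.map_map, List.mem_map] at hy
  obtain ⟨u, -, rfl⟩ := hy
  exact if_pos u.2

/-- If the core can be reached from the neighbours of the centre `v` of a merge through the active
moat `A` at the cost of the dual value inside `A` that `v` does not feel, then it can be reached
from `v` itself at the cost of the whole dual value inside `A`: the auxiliary cost of `v` is the
rest. -/
lemma MergeRecord.exists_auxReach {A R : Finset V} {v : V} {𝒟 : Finset (Finset V)} {t : ℝ}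
    (hr : I.MergeRecord 𝒞 s R A v 𝒟 t) (h : I.ProcessInv 𝒞 Tr s) (h₀ : I.IsPhaseStart 𝒞 Tr)
    (hS : S ∈ s.moats) (hR : R ∈ s.moats) (hRS : R ⊆ S)
    (hcore : I.coreOf 𝒞 R = I.coreOf 𝒞 S)
    (hvaux : IsAuxVertex s S X (.orig v))
    (hw : ∃ n : AuxVertex V, IsAuxVertex s S X n ∧ n.verts ⊆ A ∧
      (∃ u ∈ n.verts, I.G.Adj v u) ∧ ∃ c ∈ I.coreOf 𝒞 S,
        I.AuxReach 𝒞 s S (I.coreOf 𝒞 S) X n (.orig c)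
          (I.coreUnfelt 𝒞 s.y A (I.coreOf 𝒞 S) v)) :
    ∃ c ∈ I.coreOf 𝒞 S, I.AuxReach 𝒞 s S (I.coreOf 𝒞 S) X (.orig v) (.orig c)
      (I.coreDualIn 𝒞 s.y A (I.coreOf 𝒞 S)) := by
  obtain ⟨n, hn, hnA, ⟨u, hu, hvu⟩, c, hc, hreach⟩ := hw
  refine ⟨c, hc, (AuxReach.cons (a := .orig v) ⟨?_, hvaux, hn, v, by simp [AuxVertex.verts], u, hu,
    hvu⟩ hreach).mono ?_⟩
  · rintro rfl
    exact (mem_nbrs.1 hr.nbr).1 (hnA (by simp [AuxVertex.verts]))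
  · rw [← coreLoad_add_coreUnfelt (I := I) (𝒞 := 𝒞) s.y A (I.coreOf 𝒞 S) v]
    have h1 := h.auxCost_le S (I.coreOf 𝒞 S) v
    have h2 := hr.coreLoad_le h h₀ hS hR hRS hcore
    simp only [auxVertexCost]
    linarith

/-- From every vertex `x` that neighbours a moat `R ⊆ S` with the same core as `S`, the core can be
reached in `H_S` through `R` at a cost, not counting `x` itself, of at most the part of the dual
value of the core inside `R` that `x` does not feel. The costs telescope along the sequence of
merges that formed `R`: the centre of a merge feels precisely the dual that the walk has not yet
paid for. -/
lemma ProcessInv.exists_walk_of_nbr (h : I.ProcessInv 𝒞 Tr s) (h₀ : I.IsPhaseStart 𝒞 Tr)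
    (hS : S ∈ s.moats) : ∀ R ∈ s.moats, R ⊆ S → I.coreOf 𝒞 R = I.coreOf 𝒞 S →
    ∀ x ∈ I.nbrs R, ∃ n : AuxVertex V, IsAuxVertex s S X n ∧ n.verts ⊆ R ∧
      (∃ u ∈ n.verts, I.G.Adj x u) ∧ ∃ c ∈ I.coreOf 𝒞 S,
        I.AuxReach 𝒞 s S (I.coreOf 𝒞 S) X n (.orig c)
          (I.coreUnfelt 𝒞 s.y R (I.coreOf 𝒞 S) x) := by
  refine h.moat_induction ?_ ?_
  · intro C hC hCS hcore x hx
    obtain ⟨hxC, u, hu, hux⟩ := mem_nbrs.1 hx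
    rw [h₀.coreOf_eq hC] at hcore
    have hu' : u ∈ I.coreOf 𝒞 S := hcore ▸ hu
    refine ⟨.orig u, h.isAuxVertex_core h₀ hS hu', by simpa [AuxVertex.verts] using hu,
      ⟨u, by simp [AuxVertex.verts], hux.symm⟩, u, hu', AuxReach.refl _ ?_⟩
    rw [auxVertexCost, auxCost, if_pos hu']
    exact h.coreUnfelt_nonneg _ _ _
  · intro R A v 𝒟 t hR hr ih hRS hcore x hx
    have hAS := hr.subset.trans hRS
    have hcoreA := hr.core_eq.symm.trans hcore
    by_cases hxA : x ∈ I.nbrs A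
    · obtain ⟨n, hn, hnA, hadj, c, hc, hreach⟩ := ih hAS hcoreA x hxA
      exact ⟨n, hn, hnA.trans hr.subset, hadj, c, hc,
        hreach.mono (h.coreUnfelt_mono hr.subset _ _)⟩
    -- Now `x` neighbours `v` or a member of `𝒟`, and the walk passes through `v`.
    obtain ⟨hxR, u, hu, hux⟩ := mem_nbrs.1 hx
    have hvaux : IsAuxVertex s S X (.orig v) := ⟨Finset.mem_union_left _ (hRS hr.mem),
      fun D hD => hr.not_mem_superVertex h h₀ hS hR hRS hcore hD⟩
    obtain ⟨c, hc, hvreach⟩ :=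
      hr.exists_auxReach h h₀ hS hR hRS hcore hvaux (ih hAS hcoreA v hr.nbr)
    have hle := h.coreDualIn_le_coreUnfelt hr.subset (I.coreOf 𝒞 S) hxR hxA
    have hu2 := hu
    rw [hr.eq, Finset.mem_insert, Finset.mem_union, Finset.mem_biUnion] at hu
    rcases hu with rfl | huA | ⟨D, hD, huD⟩
    · exact ⟨.orig u, hvaux, by simpa [AuxVertex.verts] using hu2,
        ⟨u, by simp [AuxVertex.verts], hux.symm⟩, c, hc, hvreach.mono hle⟩
    · exact absurd (mem_nbrs.2 ⟨fun hx => hxR (hr.subset hx), u, huA, hux⟩) hxA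
    · have hDS : D ∈ superVertices s S := (h.superVertex_of_core h₀ S hS R hR hRS hcore).1 D
        ((h.mem_superVertices_iff h₀ hr).2 (Or.inr hD))
      obtain ⟨w, hw, hwv⟩ := (mem_nbrs.1 (hr.nbr' D hD)).2
      refine ⟨.super D, hDS, hr.subset' hD, ⟨u, huD, hux.symm⟩, c, hc,
        (AuxReach.cons (a := .super D) ⟨by simp, hDS, hvaux, w, hw, v, by simp [AuxVertex.verts],
          hwv⟩ hvreach).mono ?_⟩
      simpa [auxVertexCost] using hle

/-- From a vertex that neighbours `S`, the core of `S` can be reached in `H_S` at a cost of at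
most its age. -/
lemma ProcessInv.exists_auxReach_of_nbr (h : I.ProcessInv 𝒞 Tr s) (h₀ : I.IsPhaseStart 𝒞 Tr)
    (hS : S ∈ s.moats) {x : V} (hx : x ∈ I.nbrs S) (hxX : x ∈ X) : ∃ c ∈ I.coreOf 𝒞 S,
      I.AuxReach 𝒞 s S (I.coreOf 𝒞 S) X (.orig x) (.orig c)
        (I.age s.time (I.coreOf 𝒞 S)) := by
  obtain ⟨n, hn, hnS, ⟨u, hu, hxu⟩, c, hc, hreach⟩ :=
    h.exists_walk_of_nbr (X := X) h₀ hS S hS subset_rfl rfl x hx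
  have hxS := (mem_nbrs.1 hx).1
  refine ⟨c, hc, (AuxReach.cons (a := .orig x) ⟨?_, ⟨Finset.mem_union_right _ hxX, fun R hR hxR =>
    hxS (subset_of_superVertex hR hxR)⟩, hn, x, by simp [AuxVertex.verts], u, hu, hxu⟩
    hreach).mono ?_⟩
  · rintro rfl
    exact hxS (hnS (by simp [AuxVertex.verts]))
  · have h1 := h.auxCost_le S (I.coreOf 𝒞 S) x
    have h2 := coreLoad_add_coreUnfelt (I := I) (𝒞 := 𝒞) s.y S (I.coreOf 𝒞 S) x
    have h3 := h.coreDualIn_le_age S (I.coreOf 𝒞 S)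
    simp only [auxVertexCost]
    linarith

/-- From every vertex of `H_S` inside a moat `R ⊆ S` with the same core as `S`, the core can be
reached at a cost of at most the dual value of the core inside `R`. -/
lemma ProcessInv.exists_walk_of_mem (h : I.ProcessInv 𝒞 Tr s) (h₀ : I.IsPhaseStart 𝒞 Tr)
    (hS : S ∈ s.moats) : ∀ R ∈ s.moats, R ⊆ S → I.coreOf 𝒞 R = I.coreOf 𝒞 S →
    ∀ n : AuxVertex V, IsAuxVertex s S X n → n.verts ⊆ R → ∃ c ∈ I.coreOf 𝒞 S,
      I.AuxReach 𝒞 s S (I.coreOf 𝒞 S) X n (.orig c)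
        (I.coreDualIn 𝒞 s.y R (I.coreOf 𝒞 S)) := by
  refine h.moat_induction ?_ ?_
  · intro C hC hCS hcore n hn hnC
    rw [h₀.coreOf_eq hC] at hcore
    cases n with
    | orig x =>
      have hx : x ∈ I.coreOf 𝒞 S := hcore ▸ hnC (by simp [AuxVertex.verts])
      refine ⟨x, hx, AuxReach.refl _ ?_⟩
      rw [auxVertexCost, auxCost, if_pos hx]
      exact h.coreDualIn_nonneg _ _
    | super D =>
      obtain ⟨x, hx⟩ := h.nonempty h₀ (h.mem_moats_of_superVertex hn)
      exact absurd hx (Finset.disjoint_left.1 (h.superVertex_core h₀ S hS D hn).1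
        (hcore ▸ hnC hx))
  · intro R A v 𝒟 t hR hr ih hRS hcore n hn hnR
    have hAS := hr.subset.trans hRS
    have hcoreA := hr.core_eq.symm.trans hcore
    have hsv := h.superVertex_of_core h₀ S hS R hR hRS hcore
    have hmono := h.coreDualIn_mono hr.subset (I.coreOf 𝒞 S)
    have inA : n.verts ⊆ A → ∃ c ∈ I.coreOf 𝒞 S,
        I.AuxReach 𝒞 s S (I.coreOf 𝒞 S) X n (.orig c)
          (I.coreDualIn 𝒞 s.y R (I.coreOf 𝒞 S)) := by
      intro hnA
      obtain ⟨c, hc, hreach⟩ := ih hAS hcoreA n hn hnA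
      exact ⟨c, hc, hreach.mono hmono⟩
    have hvaux : IsAuxVertex s S X (.orig v) := ⟨Finset.mem_union_left _ (hRS hr.mem),
      fun D hD => hr.not_mem_superVertex h h₀ hS hR hRS hcore hD⟩
    obtain ⟨c, hc, hreach⟩ := hr.exists_auxReach h h₀ hS hR hRS hcore hvaux
      (h.exists_walk_of_nbr h₀ hS A hr.mem_moats hAS hcoreA v hr.nbr)
    cases n with
    | orig x =>
      have hxR : x ∈ R := hnR (by simp [AuxVertex.verts])
      rw [hr.eq, Finset.mem_insert, Finset.mem_union, Finset.mem_biUnion] at hxR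
      rcases hxR with rfl | hxA | ⟨D, hD, hxD⟩
      · exact ⟨c, hc, hreach.mono hmono⟩
      · exact inA (by simpa [AuxVertex.verts] using hxA)
      · exact absurd hxD (hn.2 D (hsv.1 D ((h.mem_superVertices_iff h₀ hr).2 (Or.inr hD))))
    | super D =>
      obtain ⟨x, hx⟩ := h.nonempty h₀ (h.mem_moats_of_superVertex hn)
      rcases (h.mem_superVertices_iff h₀ hr).1 (hsv.2 D hn x hx (hnR hx)) with hDA | hDD
      · exact inA (subset_of_superVertex hDA)
      · obtain ⟨w, hw, hwv⟩ := (mem_nbrs.1 (hr.nbr' D hDD)).2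
        refine ⟨c, hc, (AuxReach.cons (a := .super D) ⟨by simp, hn, hvaux, w, hw, v,
          by simp [AuxVertex.verts], hwv⟩ hreach).mono ?_⟩
        simpa [auxVertexCost] using hmono

lemma ProcessInv.exists_auxReach_of_mem (h : I.ProcessInv 𝒞 Tr s) (h₀ : I.IsPhaseStart 𝒞 Tr)
    (hS : S ∈ s.moats) {n : AuxVertex V} (hn : IsAuxVertex s S X n) (hnS : n.verts ⊆ S) :
    ∃ c ∈ I.coreOf 𝒞 S, I.AuxReach 𝒞 s S (I.coreOf 𝒞 S) X n (.orig c)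
        (I.age s.time (I.coreOf 𝒞 S)) := by
  obtain ⟨c, hc, hreach⟩ := h.exists_walk_of_mem h₀ hS S hS subset_rfl rfl n hn hnS
  exact ⟨c, hc, hreach.mono (h.coreDualIn_le_age _ _)⟩

/-- Walks via the core of `S` connect any two vertices that are within reach of it. -/
lemma ProcessInv.exists_isPath_via_core (h : I.ProcessInv 𝒞 Tr s) (h₀ : I.IsPhaseStart 𝒞 Tr)
    (hS : S ∈ s.moats)
    (ha : ∃ c ∈ I.coreOf 𝒞 S, I.AuxReach 𝒞 s S (I.coreOf 𝒞 S) X a (.orig c)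
      (I.age s.time (I.coreOf 𝒞 S)))
    (hb : ∃ c ∈ I.coreOf 𝒞 S, I.AuxReach 𝒞 s S (I.coreOf 𝒞 S) X b (.orig c)
      (I.age s.time (I.coreOf 𝒞 S))) :
    ∃ p : (I.auxGraph s S X).Walk a b, p.IsPath ∧
      I.pathCost 𝒞 s S (I.coreOf 𝒞 S) p ≤ 2 * I.age s.time (I.coreOf 𝒞 S) := by
  obtain ⟨c, hc, hac⟩ := ha
  obtain ⟨c', hc', hbc⟩ := hb
  have := (hac.trans h (h.auxReach_core h₀ hS hc hc')).trans h hbc.symm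
  exact (this.mono (by linarith)).exists_isPath h

/-- In `H_S` there is a path of cost at most twice the age of the core from any vertex in the core
or neighbouring `S` to any vertex set that meets `S` or `Γ(S)`. -/
lemma ProcessInv.exists_isPath_to_tree (h : I.ProcessInv 𝒞 Tr s) (h₀ : I.IsPhaseStart 𝒞 Tr)
    (hS : S ∈ s.moats) {z : V} (hz : z ∈ I.coreOf 𝒞 S ∨ z ∈ I.nbrs S) {T : Finset V}
    (hT : (T ∩ (S ∪ I.nbrs S)).Nonempty) :
    ∃ (t : AuxVertex V) (p : (I.auxGraph s S (insert z T)).Walk (.orig z) t), p.IsPath ∧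
      t.Meets T ∧ I.pathCost 𝒞 s S (I.coreOf 𝒞 S) p ≤ 2 * I.age s.time (I.coreOf 𝒞 S) := by
  have hzr : ∃ c ∈ I.coreOf 𝒞 S, I.AuxReach 𝒞 s S (I.coreOf 𝒞 S) (insert z T) (.orig z) (.orig c)
      (I.age s.time (I.coreOf 𝒞 S)) := by
    rcases hz with hz | hz
    · refine ⟨z, hz, AuxReach.refl _ ?_⟩
      rw [auxVertexCost, auxCost, if_pos hz]
      exact I.age_nonneg h.time_nonneg _
    · exact h.exists_auxReach_of_nbr h₀ hS hz (Finset.mem_insert_self _ _)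
  have htr : ∃ t : AuxVertex V, t.Meets T ∧ ∃ c ∈ I.coreOf 𝒞 S,
      I.AuxReach 𝒞 s S (I.coreOf 𝒞 S) (insert z T) t (.orig c)
        (I.age s.time (I.coreOf 𝒞 S)) := by
    obtain ⟨x, hx⟩ := hT
    rw [Finset.mem_inter, Finset.mem_union] at hx
    obtain ⟨hxT, hxS | hxS⟩ := hx
    · by_cases hex : ∃ R ∈ superVertices s S, x ∈ R
      · obtain ⟨R, hR, hxR⟩ := hex
        exact ⟨.super R, ⟨x, Finset.mem_inter.2 ⟨hxR, hxT⟩⟩,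
          h.exists_auxReach_of_mem h₀ hS (n := .super R) hR (subset_of_superVertex hR)⟩
      · push Not at hex
        exact ⟨.orig x, ⟨x, by simpa [AuxVertex.verts] using hxT⟩,
          h.exists_auxReach_of_mem h₀ hS (n := .orig x) ⟨Finset.mem_union_left _ hxS, hex⟩
            (by simpa [AuxVertex.verts] using hxS)⟩
    · exact ⟨.orig x, ⟨x, by simpa [AuxVertex.verts] using hxT⟩,
        h.exists_auxReach_of_nbr h₀ hS hxS (Finset.mem_insert_of_mem hxT)⟩
  obtain ⟨t, htT, htr⟩ := htr
  obtain ⟨p, hp, hcost⟩ := h.exists_isPath_via_core h₀ hS hzr htr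
  exact ⟨t, p, hp, htT, hcost⟩

end Walks


/-! ### Bounding the charges -/

section Charges

variable {I : NWPCST V} {𝒞 : Finset (Finset V)} {Tr : Finset V} {s : DualState V}

lemma mem_origVerts [Fintype V] {H : SimpleGraph (AuxVertex V)} {a b : AuxVertex V}
    {p : H.Walk a b} {x : V} : x ∈ origVerts p ↔ AuxVertex.orig x ∈ p.support := by
  simp [origVerts]

variable [DecidableEq V]

/-- The invariant of the tree construction: all charges are within the bounds, and a component that
the tree does not touch has not been charged. -/
structure ChargesOk (I : NWPCST V) (𝒞 : Finset (Finset V)) (s : DualState V) (B : BuildState V) :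
    Prop where
  untouched : ∀ D ∈ 𝒞, Disjoint D B.tree → B.charge₁ D = 0 ∧ B.charge₂ D = 0 ∧ B.charge₃ D = 0
  le : ∀ D ∈ 𝒞, B.charge₁ D ≤ 2 * I.age s.time D ∧ B.charge₂ D ≤ 4 * I.age s.time D ∧
    B.charge₃ D ≤ I.age s.time D

/-- `B'` arises from `B` by adding vertices of `W` to the tree and charging components inside
members of `rs`, and keeps the invariant of the construction. -/
structure Extends (I : NWPCST V) (𝒞 : Finset (Finset V)) (s : DualState V) (W : Finset V)
    (rs : Finset (Finset V)) (B B' : BuildState V) : Prop where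
  subset : B.tree ⊆ B'.tree
  subset' : B'.tree ⊆ B.tree ∪ W
  same : ∀ D ∈ 𝒞, (∀ R ∈ rs, ¬ D ⊆ R) →
    B'.charge₁ D = B.charge₁ D ∧ B'.charge₂ D = B.charge₂ D ∧ B'.charge₃ D = B.charge₃ D
  ok : I.ChargesOk 𝒞 s B → I.ChargesOk 𝒞 s B'

variable {W W' : Finset V} {rs rs' : Finset (Finset V)} {B B₁ B₂ B' : BuildState V}

lemma Extends.mono (h : I.Extends 𝒞 s W rs B B') (hW : B.tree ∪ W ⊆ B.tree ∪ W')
    (hrs : ∀ R ∈ rs, ∃ R' ∈ rs', R ⊆ R') : I.Extends 𝒞 s W' rs' B B' where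
  subset := h.subset
  subset' := h.subset'.trans hW
  same D hD hDrs := h.same D hD fun R hR hDR => by
    obtain ⟨R', hR', hRR'⟩ := hrs R hR
    exact hDrs R' hR' (hDR.trans hRR')
  ok := h.ok

lemma Extends.trans (h : I.Extends 𝒞 s W rs B B₁) (h' : I.Extends 𝒞 s W rs B₁ B₂) :
    I.Extends 𝒞 s W rs B B₂ where
  subset := h.subset.trans h'.subset
  subset' := h'.subset'.trans (Finset.union_subset h.subset' Finset.subset_union_right)
  same D hD hDrs := by
    obtain ⟨e1, e2, e3⟩ := h.same D hD hDrs
    obtain ⟨e1', e2', e3'⟩ := h'.same D hD hDrs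
    exact ⟨e1'.trans e1, e2'.trans e2, e3'.trans e3⟩
  ok hB := h'.ok (h.ok hB)

lemma Extends.refl (B : BuildState V) : I.Extends 𝒞 s W rs B B :=
  ⟨subset_rfl, Finset.subset_union_left, fun _ _ _ => ⟨rfl, rfl, rfl⟩, id⟩

lemma Extends.addVerts (hW : W' ⊆ B.tree ∪ W) : I.Extends 𝒞 s W rs B (B.addVerts W') where
  subset := Finset.subset_union_left
  subset' := Finset.union_subset Finset.subset_union_left hW
  same _ _ _ := ⟨rfl, rfl, rfl⟩
  ok hB := ⟨fun D hD hdisj => hB.untouched D hD (hdisj.mono_right Finset.subset_union_left), hB.le⟩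

variable [Fintype V]

/-- What a call of FindSubTree does: it is made on a moat `S` that the tree does not touch, adds
only vertices of `S`, charges only components inside `S`, and keeps the invariant. -/
def FindSubTreeSpec (I : NWPCST V) (𝒞 : Finset (Finset V)) (s : DualState V) (S L : Finset V)
    (B B' : BuildState V) : Prop :=
  S ∈ s.moats → L ⊆ I.nbrs S → L ⊆ B.tree → Disjoint S B.tree → I.Extends 𝒞 s S {S} B B'

/-- What a sequence of calls of FindSubTree does. -/
def FindSubTreesSpec (I : NWPCST V) (𝒞 : Finset (Finset V)) (s : DualState V)
    (rs : Finset (Finset V)) (Q : Finset V) (B B' : BuildState V) : Prop :=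
  (∀ R ∈ rs, R ∈ s.moats) → (∀ R ∈ rs, ∀ R' ∈ rs, R ≠ R' → Disjoint R R') → Q ⊆ B.tree →
    (∀ R ∈ rs, Disjoint R B.tree) → I.Extends 𝒞 s (rs.biUnion id) rs B B'

/-- What a call of ConnectVertex does: it starts from a vertex `z` of the core of `S`, or from a
neighbour `z` of `S` that has already been paid for; it charges only components inside
super-vertices of `S`, so not the core of `S`; and the costs that it passes on are bounded in terms
of the age of the core of `S`. -/
def ConnectVertexSpec (I : NWPCST V) (𝒞 : Finset (Finset V)) (s : DualState V) (S : Finset V)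
    (z : V) (paid : Finset V) (B B' : BuildState V) (x₂ x₃ : ℝ) : Prop :=
  S ∈ s.moats → (z ∈ I.coreOf 𝒞 S ∨ z ∈ I.nbrs S ∧ z ∈ paid) →
    (B.tree ∩ (S ∪ I.nbrs S)).Nonempty →
    I.Extends 𝒞 s (insert z S) (superVertices s S) B B' ∧
      x₂ ≤ 4 * I.age s.time (I.coreOf 𝒞 S) ∧ x₃ ≤ I.age s.time (I.coreOf 𝒞 S)

/-- The calls of FindSubTree along a path `q` in `H_S`: if the super-vertices in `rs` are not
touched by the tree before the vertices of `q` are added, then they are not touched by it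
afterwards. -/
lemma ProcessInv.extends_path (h : I.ProcessInv 𝒞 Tr s) (h₀ : I.IsPhaseStart 𝒞 Tr) {S X : Finset V}
    (hS : S ∈ s.moats) {a b : AuxVertex V} (q : (I.auxGraph s S X).Walk a b)
    (ha : IsAuxVertex s S X a) (hrs : rs ⊆ superVertices s S) (hdisj : ∀ R ∈ rs, Disjoint R B.tree)
    (hX : X ⊆ B.tree ∪ W) (hW : S ⊆ W)
    (hcall : I.FindSubTreesSpec 𝒞 s rs (origVerts q) (B.addVerts (origVerts q)) B') :
    I.Extends 𝒞 s W (superVertices s S) B B' := by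
  have haux : ∀ x ∈ origVerts q, IsAuxVertex s S X (.orig x) := fun x hx =>
    isAuxVertex_of_mem_support q ha _ (mem_origVerts.1 hx)
  have hqW : origVerts q ⊆ B.tree ∪ W := fun x hx => by
    rcases Finset.mem_union.1 (haux x hx).1 with hxS | hxX
    · exact Finset.mem_union_right _ (hW hxS)
    · exact hX hxX
  refine (Extends.addVerts hqW).trans ((hcall ?_ ?_ Finset.subset_union_right ?_).mono ?_ ?_)
  · exact fun R hR => h.mem_moats_of_superVertex (hrs hR)
  · exact fun R hR R' hR' hne => h.superVertex_disjoint h₀ S hS R (hrs hR) R' (hrs hR') hne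
  · intro R hR
    refine Finset.disjoint_union_right.2 ⟨hdisj R hR, Finset.disjoint_right.2 fun x hx => ?_⟩
    exact (haux x hx).2 R (hrs hR)
  · refine Finset.union_subset_union subset_rfl (Finset.biUnion_subset.2 fun R hR => ?_)
    exact (subset_of_superVertex (hrs hR)).trans hW
  · exact fun R hR => ⟨R, hrs hR, subset_rfl⟩

lemma isAuxVertex_of_mem_nbrs {S X : Finset V} {x : V} (hx : x ∈ I.nbrs S) (hxX : x ∈ X) :
    IsAuxVertex s S X (.orig x) :=
  ⟨Finset.mem_union_right _ hxX, fun _ hR hxR =>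
    (mem_nbrs.1 hx).1 (subset_of_superVertex hR hxR)⟩

lemma ProcessInv.findSubTree_intro (h : I.ProcessInv 𝒞 Tr s) (h₀ : I.IsPhaseStart 𝒞 Tr)
    {S L C : Finset V} {a b z : V} {x₂ x₃ : ℝ} (hC : I.IsCore 𝒞 s.time S C) (hL : L = {a, b})
    (p : (I.auxGraph s S L).Walk (.orig a) (.orig b))
    (hmin : ∀ q : (I.auxGraph s S L).Walk (.orig a) (.orig b), q.IsPath →
      I.pathCost 𝒞 s S C p ≤ I.pathCost 𝒞 s S C q)
    (hsub : I.FindSubTreesSpec 𝒞 s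
      ((superVertices s S).filter fun R => (I.nbrs R ∩ origVerts p).Nonempty)
      (origVerts p) (B.addVerts (origVerts p)) B₁)
    (hz : z ∈ C) (hconn : I.ConnectVertexSpec 𝒞 s S z ∅ B₁ B₂ x₂ x₃) :
    I.FindSubTreeSpec 𝒞 s S L B
      ((B₂.addVerts C).charge C (I.pathCost 𝒞 s S C p) x₂ x₃) := by
  intro hS hLS hLB hdisj
  obtain rfl := (h.dom S hS).isCore_iff.1 hC
  have haL : a ∈ L := by simp [hL]
  have hbL : b ∈ L := by simp [hL]
  have hCS := h.coreOf_subset hS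
  have hpath : I.pathCost 𝒞 s S (I.coreOf 𝒞 S) p ≤ 2 * I.age s.time (I.coreOf 𝒞 S) := by
    obtain ⟨q, hq, hcost⟩ := h.exists_isPath_via_core h₀ hS
      (h.exists_auxReach_of_nbr h₀ hS (hLS haL) haL) (h.exists_auxReach_of_nbr h₀ hS (hLS hbL) hbL)
    exact (hmin q hq).trans hcost
  have hext₁ : I.Extends 𝒞 s S (superVertices s S) B B₁ :=
    h.extends_path h₀ hS p (isAuxVertex_of_mem_nbrs (hLS haL) haL) (Finset.filter_subset _ _)
      (fun R hR => hdisj.mono_left (subset_of_superVertex (Finset.mem_filter.1 hR).1))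
      (hLB.trans Finset.subset_union_left) subset_rfl hsub
  obtain ⟨hext₂, hx₂, hx₃⟩ := hconn hS (Or.inl hz)
    ⟨a, Finset.mem_inter.2 ⟨hext₁.subset (hLB haL), Finset.mem_union_right _ (hLS haL)⟩⟩
  rw [Finset.insert_eq_self.2 (hCS hz)] at hext₂
  have hext := hext₁.trans hext₂
  refine ⟨hext.subset.trans Finset.subset_union_left,
    Finset.union_subset hext.subset' (hCS.trans Finset.subset_union_right), ?_, ?_⟩
  · intro D hD hDS
    have hDS' : ¬ D ⊆ S := hDS S (Finset.mem_singleton_self S)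
    have hne : D ≠ I.coreOf 𝒞 S := fun heq => hDS' (heq ▸ hCS)
    have := hext.same D hD fun R hR hDR => hDS' (hDR.trans (subset_of_superVertex hR))
    simpa [BuildState.charge, BuildState.addVerts, Function.update_of_ne hne] using this
  · intro hB
    have hB₂ := hext.ok hB
    -- The core has not been charged before: it was untouched at the time of the call, and the
    -- recursive calls only charge components inside super-vertices.
    have hzero : B₂.charge₁ (I.coreOf 𝒞 S) = 0 ∧ B₂.charge₂ (I.coreOf 𝒞 S) = 0 ∧
        B₂.charge₃ (I.coreOf 𝒞 S) = 0 := by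
      obtain ⟨e1, e2, e3⟩ := hext.same _ (h.coreOf_mem hS)
        fun R hR => h.core_not_subset_superVertex h₀ hS hR
      rw [e1, e2, e3]
      exact hB.untouched _ (h.coreOf_mem hS) (hdisj.mono_left hCS)
    constructor
    · intro D hD hDdisj
      have hDdisj' : Disjoint D (B₂.tree ∪ I.coreOf 𝒞 S) := hDdisj
      rw [Finset.disjoint_union_right] at hDdisj'
      have hne : D ≠ I.coreOf 𝒞 S := by
        rintro rfl
        exact (h₀.nonempty hD).ne_empty (disjoint_self.1 hDdisj'.2)
      have := hB₂.untouched D hD hDdisj'.1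
      simpa [BuildState.charge, BuildState.addVerts, Function.update_of_ne hne] using this
    · intro D hD
      by_cases hne : D = I.coreOf 𝒞 S
      · subst hne
        simp only [BuildState.charge, BuildState.addVerts, Function.update_self, hzero, zero_add]
        exact ⟨hpath, hx₂, hx₃⟩
      · have := hB₂.le D hD
        simpa [BuildState.charge, BuildState.addVerts, Function.update_of_ne hne] using this

lemma findSubTrees_cons {R Q : Finset V} (hR : R ∈ rs)
    (hcall : I.FindSubTreeSpec 𝒞 s R (I.nbrs R ∩ Q) B B₁)
    (hrest : I.FindSubTreesSpec 𝒞 s (rs.erase R) Q B₁ B₂) :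
    I.FindSubTreesSpec 𝒞 s rs Q B B₂ := by
  intro hm hdisj hQ hB
  have h1 := hcall (hm R hR) Finset.inter_subset_left (Finset.inter_subset_right.trans hQ) (hB R hR)
  have h2 := hrest (fun R' hR' => hm R' (Finset.mem_of_mem_erase hR'))
    (fun R' hR' R'' hR'' hne => hdisj R' (Finset.mem_of_mem_erase hR') R''
      (Finset.mem_of_mem_erase hR'') hne) (hQ.trans h1.subset)
    (fun R' hR' => Disjoint.mono_right h1.subset' (Finset.disjoint_union_right.2
      ⟨hB R' (Finset.mem_of_mem_erase hR'), hdisj R' (Finset.mem_of_mem_erase hR') R hR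
        (Finset.ne_of_mem_erase hR')⟩))
  refine (h1.mono ?_ ?_).trans (h2.mono ?_ ?_)
  · exact Finset.union_subset_union subset_rfl (Finset.subset_biUnion_of_mem id hR)
  · intro R' hR'
    exact ⟨R, hR, (Finset.mem_singleton.1 hR').subset⟩
  · exact Finset.union_subset_union subset_rfl
      (Finset.biUnion_subset_biUnion_of_subset_left id (Finset.erase_subset _ _))
  · exact fun R' hR' => ⟨R', Finset.mem_of_mem_erase hR', subset_rfl⟩

/-- The start of a call of ConnectVertex is a vertex of the auxiliary graph. -/
lemma ProcessInv.isAuxVertex_start (h : I.ProcessInv 𝒞 Tr s) (h₀ : I.IsPhaseStart 𝒞 Tr)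
    {S T : Finset V} (hS : S ∈ s.moats) {z : V} (hz : z ∈ I.coreOf 𝒞 S ∨ z ∈ I.nbrs S) :
    IsAuxVertex s S (insert z T) (.orig z) :=
  hz.elim (h.isAuxVertex_core h₀ hS) fun hz =>
    isAuxVertex_of_mem_nbrs hz (Finset.mem_insert_self _ _)

lemma ProcessInv.shortest_le (h : I.ProcessInv 𝒞 Tr s) (h₀ : I.IsPhaseStart 𝒞 Tr)
    {S T : Finset V} (hS : S ∈ s.moats) {z : V} (hz : z ∈ I.coreOf 𝒞 S ∨ z ∈ I.nbrs S)
    (hT : (T ∩ (S ∪ I.nbrs S)).Nonempty) {t : AuxVertex V}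
    {p : (I.auxGraph s S (insert z T)).Walk (.orig z) t}
    (hp : I.IsShortestToTree 𝒞 s S (I.coreOf 𝒞 S) T p) :
    I.pathCost 𝒞 s S (I.coreOf 𝒞 S) p ≤ 2 * I.age s.time (I.coreOf 𝒞 S) := by
  obtain ⟨t', q, hq, htT, hcost⟩ := h.exists_isPath_to_tree h₀ hS hz hT
  exact (hp.2.2.2 t' q hq htT).trans hcost

lemma ProcessInv.connectVertex_last (h : I.ProcessInv 𝒞 Tr s) (h₀ : I.IsPhaseStart 𝒞 Tr)
    {S C : Finset V} {z t : V} {paid : Finset V} (hC : I.IsCore 𝒞 s.time S C)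
    (q : (I.auxGraph s S (insert z B.tree)).Walk (.orig z) (.orig t))
    (hq : I.IsShortestToTree 𝒞 s S C B.tree q)
    (hsub : I.FindSubTreesSpec 𝒞 s
      ((superVertices s S).filter fun R =>
        R ∩ B.tree = ∅ ∧ (I.nbrs R ∩ origVerts q).Nonempty)
      (origVerts q) (B.addVerts (origVerts q)) B') :
    I.ConnectVertexSpec 𝒞 s S z paid B B' (I.pathCost 𝒞 s S C q) 0 := by
  intro hS hz hT
  obtain rfl := (h.dom S hS).isCore_iff.1 hC
  have hz' := hz.imp_right And.left
  have hage := I.age_nonneg h.time_nonneg (I.coreOf 𝒞 S)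
  have hcost := h.shortest_le h₀ hS hz' hT hq
  refine ⟨h.extends_path h₀ hS q (h.isAuxVertex_start h₀ hS hz') (Finset.filter_subset _ _)
    (fun R hR => Finset.disjoint_iff_inter_eq_empty.2 (Finset.mem_filter.1 hR).2.1) ?_
    (Finset.subset_insert _ _) hsub, by linarith, hage⟩
  exact Finset.insert_subset (Finset.mem_union_right _ (Finset.mem_insert_self _ _))
    Finset.subset_union_left

/-- A step of the chain of ConnectVertex calls from `S` to its super-vertex `R`. The core of `R` is
at most half as old as that of `S`, so the bounds for the rest of the chain leave room for the path
in `H_S` and for the vertex `z'` through which the chain enters `R`. -/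
lemma ProcessInv.connectVertex_step (h : I.ProcessInv 𝒞 Tr s) (h₀ : I.IsPhaseStart 𝒞 Tr)
    {S C R : Finset V} {z z' : V} {paid : Finset V} {x₂ x₃ : ℝ} (hC : I.IsCore 𝒞 s.time S C)
    (q : (I.auxGraph s S (insert z B.tree)).Walk (.orig z) (.orig z'))
    (hadj : (I.auxGraph s S (insert z B.tree)).Adj (.orig z') (.super R))
    (hq : I.IsShortestToTree 𝒞 s S C B.tree (q.concat hadj))
    (hrec : I.ConnectVertexSpec 𝒞 s R z' (insert z' paid) B B₁ x₂ x₃)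
    (hsub : I.FindSubTreesSpec 𝒞 s
      ((superVertices s S).filter fun R' =>
        R' ∩ B.tree = ∅ ∧ (I.nbrs R' ∩ origVerts q).Nonempty)
      (origVerts q) (B₁.addVerts (origVerts q)) B') :
    I.ConnectVertexSpec 𝒞 s S z paid B B' (I.pathCost 𝒞 s S C q + x₂)
      ((if z' ∈ paid then 0 else I.rc z' - I.auxCost 𝒞 s S C z') + x₃) := by
  intro hS hz hT
  obtain rfl := (h.dom S hS).isCore_iff.1 hC
  have hz₁ := hz.imp_right And.left
  have hage := I.age_nonneg h.time_nonneg (I.coreOf 𝒞 S)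
  have hcost := h.shortest_le h₀ hS hz₁ hT hq
  rw [pathCost_concat_super] at hcost
  have hzaux := h.isAuxVertex_start (T := B.tree) h₀ hS hz₁
  obtain ⟨-, hz'aux, hR, u, hu, w, hw, huw⟩ := id hadj
  have hR : R ∈ superVertices s S := hR
  obtain rfl : u = z' := by simpa [AuxVertex.verts] using hu
  have huR : u ∈ I.nbrs R := mem_nbrs.2 ⟨hz'aux.2 R hR, w, hw, huw.symm⟩
  obtain ⟨hCR, hCR', hhalf⟩ := h.superVertex_core h₀ S hS R hR
  have huC : u ∉ I.coreOf 𝒞 S := fun hu => Finset.disjoint_left.1 hCR' hu huR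
  have hRT : (AuxVertex.super R).Meets B.tree := hq.2.1
  -- The path meets the tree in its last vertex only.
  have huT : u ∉ B.tree := by
    intro huT
    have := hq.2.2.1 (.orig u) (SimpleGraph.Walk.support_subset_support_concat _ _
      q.end_mem_support) ⟨u, by simpa [AuxVertex.verts] using huT⟩
    exact absurd this (by simp)
  have huS : u ∈ insert z S := by
    rcases Finset.mem_union.1 hz'aux.1 with huS | huX
    · exact Finset.mem_insert_of_mem huS
    · rw [(Finset.mem_insert.1 huX).resolve_right huT]
      exact Finset.mem_insert_self _ _
  obtain ⟨hext, hx₂, hx₃⟩ := hrec (h.mem_moats_of_superVertex hR)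
    (Or.inr ⟨huR, Finset.mem_insert_self _ _⟩) (by
      obtain ⟨x, hx⟩ := hRT
      rw [Finset.mem_inter] at hx
      exact ⟨x, Finset.mem_inter.2 ⟨hx.2, Finset.mem_union_left _ hx.1⟩⟩)
  have hext₁ : I.Extends 𝒞 s (insert z S) (superVertices s S) B B₁ := by
    refine hext.mono (Finset.union_subset_union subset_rfl (Finset.insert_subset huS
      ((subset_of_superVertex hR).trans (Finset.subset_insert _ _)))) fun R' hR' => ?_
    exact ⟨R, hR, subset_of_superVertex hR'⟩
  have hext₂ : I.Extends 𝒞 s (insert z S) (superVertices s S) B₁ B' := by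
    refine h.extends_path h₀ hS q hzaux (Finset.filter_subset _ _) (fun R' hR' => ?_) ?_
      (Finset.subset_insert _ _) hsub
    · obtain ⟨hR'S, hR'T, -⟩ := Finset.mem_filter.1 hR'
      have hne : R' ≠ R := by
        rintro rfl
        exact hRT.ne_empty hR'T
      refine Disjoint.mono_right hext.subset' (Finset.disjoint_union_right.2
        ⟨Finset.disjoint_iff_inter_eq_empty.2 hR'T, Finset.disjoint_insert_right.2
          ⟨hz'aux.2 R' hR'S, h.superVertex_disjoint h₀ S hS R' hR'S R hR hne⟩⟩)
    · exact Finset.insert_subset (Finset.mem_union_right _ (Finset.mem_insert_self _ _))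
        (hext.subset.trans Finset.subset_union_left)
  refine ⟨hext₁.trans hext₂, by linarith, ?_⟩
  split_ifs with hpaid
  · linarith
  · have huS' : u ∈ S := by
      rcases Finset.mem_insert.1 huS with rfl | huS
      · rcases hz with hz | hz
        · exact absurd hz huC
        · exact absurd hz.2 hpaid
      · exact huS
    have := h.rc_sub_auxCost_le h₀ hS huS' huC hz'aux.2
    linarith

theorem FindSubTrees.spec (h : I.ProcessInv 𝒞 Tr s) (h₀ : I.IsPhaseStart 𝒞 Tr) {Q : Finset V}
    (hcalls : FindSubTrees I 𝒞 s rs Q B B') : I.FindSubTreesSpec 𝒞 s rs Q B B' := by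
  refine FindSubTrees.rec (I := I) (𝒞 := 𝒞) (s := s)
    (motive_1 := fun S L B B' _ => I.FindSubTreeSpec 𝒞 s S L B B')
    (motive_2 := fun rs Q B B' _ => I.FindSubTreesSpec 𝒞 s rs Q B B')
    (motive_3 := fun S z paid B B' x₂ x₃ _ => I.ConnectVertexSpec 𝒞 s S z paid B B' x₂ x₃)
    ?_ ?_ ?_ ?_ ?_ hcalls
  · intro S L C a b z B B₁ B₂ x₂ x₃ hC hL p _ hmin _ hz _ hsub hconn
    exact h.findSubTree_intro h₀ hC hL p hmin hsub hz hconn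
  · intro Q B _ _ _ _
    exact Extends.refl B
  · intro rs R Q B B₁ B₂ hR _ _ hcall hrest
    exact findSubTrees_cons hR hcall hrest
  · intro S C z t paid B B' hC q hq _ hsub
    exact h.connectVertex_last h₀ hC q hq hsub
  · intro S C R z z' paid B B₁ B' x₂ x₃ hC q hadj hq _ _ hrec hsub
    exact h.connectVertex_step h₀ hC q hadj hq hrec hsub

/-- The charges of a phase tree are within the bounds. -/
theorem BuildsTree.chargesOk (h : I.ProcessInv 𝒞 Tr s) (h₀ : I.IsPhaseStart 𝒞 Tr) {v : V}
    (hB : I.BuildsTree 𝒞 s v B) : I.ChargesOk 𝒞 s B := by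
  refine (FindSubTrees.spec h h₀ hB (fun R hR => h.cur_sub (mem_moatsAt.1 hR).1)
    (fun R hR R' hR' hne => h.disj R (mem_moatsAt.1 hR).1 R' (mem_moatsAt.1 hR').1 hne) subset_rfl
    fun R hR => ?_).ok ⟨fun _ _ _ => ⟨rfl, rfl, rfl⟩, fun D _ => ?_⟩
  · exact Finset.disjoint_singleton_right.2 (mem_nbrs.1 (mem_moatsAt.1 hR).2).1
  · have := I.age_nonneg h.time_nonneg D
    refine ⟨?_, ?_, ?_⟩ <;> dsimp only <;> linarith

end Charges

end NWPCST

theorem mainTheorem4 {V : Type*} [Fintype V] [DecidableEq V] (I : NWPCST V)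
    (𝒞 : Finset (Finset V)) (Tr : Finset V) (hstart : I.IsPhaseStart 𝒞 Tr)
    (s : NWPCST.DualState V) (hs : I.Reaches 𝒞 Tr s)
    (v : V) (hv : I.EndsAt 𝒞 Tr s v)
    (B : NWPCST.BuildState V) (hB : I.BuildsTree 𝒞 s v B)
    (C : Finset V) (hC : C ∈ 𝒞) :
    B.charge₁ C ≤ 2 * I.age s.time C ∧
      B.charge₂ C ≤ 4 * I.age s.time C ∧
      B.charge₃ C ≤ I.age s.time C ∧
      B.totalCharge C ≤ 7 * I.age s.time C := by
  obtain ⟨h1, h2, h3⟩ := (hB.chargesOk (hs.processInv hstart) hstart).le C hC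
  refine ⟨h1, h2, h3, ?_⟩
  unfold NWPCST.BuildState.totalCharge
  linarith
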